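/- Let $H_1$ and $G_1$ be real Hilbert spaces, let $S_1\colon H_1\to G_1$ be a compact linear operator, and let $\lambda_1\ge\lambda_2\ge\dots\ge 0$ be the eigenvalues of $S_1^\dagger S_1$ (counted with multiplicity, extended by zeros). Assume $\lambda_2>0$. For $d\in\mathbb N=\{1,2,\dots\}$ let $H_d$ and $G_d$ be the $d$-fold Hilbert space tensor powers of $H_1$ and $G_1$, and let $S_d=S_1\otimes\dots\otimes S_1\colon H_d\to G_d$. Let $(s_d)_{d\in\mathbb N}$ be positive numbers, let $F_d$ be the space $H_d$ with the inner product $\langle\cdot,\cdot\rangle_{F_d}=s_d^{-1}\langle\cdot,\cdot\rangle_{H_d}$, and let $S_{d,s_d}\colon F_d\to G_d$ be the operator $S_d$ with source space $F_d$. The sequence $S_{(s)}=(S_{d,s_d})_{d\in\mathbb N}$ is called a scaled tensor product problem. The worst case error of an algorithm $A\colon F_d\to G_d$ is $\Delta(A)=\sup_{\|f\|_{F_d}\le1}\|S_{d,s_d}f-A(f)\|_{G_d}$. The algorithms with $n$ information operations are the maps $A(f)=\sum_{j=1}^nL_j(f)\,g_j$ with continuous linear functionals $L_j$ on $F_d$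 and $g_j\in G_d$ (linear algorithms); alternatively, they are the maps $A(f)=\varphi(y_1,\dots,y_n)$ with $y_j=L_j(f;y_1,\dots,y_{j-1})$, where $\varphi$ is arbitrary and each $L_j(\,\cdot\,;y_1,\dots,y_{j-1})$ is a continuous linear functional on $F_d$ (adaptive algorithms). The statement holds for each of these two classes. The initial error $\epsilon_d^{\mathrm{init}}$ is the infimum of $\Delta(A)$ over the algorithms with $n=0$, and the information complexity for the normalized error criterion is $$n(\epsilon,d)=n(\epsilon,d;S_{d,s_d})=\min\{n\in\mathbb N_0 : \Delta(A)\le\epsilon\,\epsilon_d^{\mathrm{init}}\text{ for some algorithm }A\text{ with }n\text{ information operations}\},\qquad \epsilon>0.$$ The problem $S_{(s)}$ * suffers from the curse of dimensionality if for some $\epsilon>0$ there are $C,\gamma>0$ such that $n(\epsilon,d)\ge C(1+\gamma)^d$ for infinitely many $d$; * is polynomially tractable if there are $C,p>0$ and $q\ge0$ such that $n(\epsilon,d)\le C\epsilon^{-p}d^{\,q}$ for all $d\in\mathbb N$ and $\epsilon\in(0,1]$; * is weakly tractable if $\ln n(\epsilon,d)/(\epsilon^{-1}+d)\to0$ as $\epsilon^{-1}+d\to\infty$,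 where $0<\epsilon<1$ and $d\in\mathbb N$. **Theorem.** For every scaled tensor product problem with $\lambda_2>0$ and the normalized error criterion: 1. The scaling has no effect: $n(\epsilon,d;S_{d,s_d})=n(\epsilon,d;S_d)$ for all $d\in\mathbb N$ and $\epsilon>0$. 2. If $\lambda_1=\lambda_2$, then $S_{(s)}$ suffers from the curse of dimensionality. 3. If $\lambda_1>\lambda_2$, then $S_{(s)}$ is not polynomially tractable, and it is weakly tractable if and only if $\lambda_n\in o(\ln^{-2}n)$ as $n\to\infty$. -/

import Mathlib

open Filter Topology Asymptotics
open scoped ENNReal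

namespace ScaledTensor

noncomputable section

/-! ### Hilbert space tensor powers -/

section TensorPower

variable (H : Type*) [NormedAddCommGroup H] [InnerProductSpace ℝ H]
variable {G : Type*} [NormedAddCommGroup G] [InnerProductSpace ℝ G]

/-- The algebraic tensor power `H ⊗ ⋯ ⊗ H` (`d` factors). It is a type of its own, because
Mathlib equips `⨂[ℝ] _ : Fin d, H` with the projective norm, which is not the Hilbert space norm. -/
def AlgPower (d : ℕ) : Type _ := PiTensorProduct ℝ (fun _ : Fin d => H)

instance (d : ℕ) : AddCommGroup (AlgPower H d) :=
  inferInstanceAs (AddCommGroup (PiTensorProduct ℝ (fun _ : Fin d => H)))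

instance (d : ℕ) : Module ℝ (AlgPower H d) :=
  inferInstanceAs (Module ℝ (PiTensorProduct ℝ (fun _ : Fin d => H)))

variable {H}

/-- The simple tensor `f₁ ⊗ ⋯ ⊗ f_d` in the algebraic tensor power. -/
def algTensor {d : ℕ} (f : Fin d → H) : AlgPower H d :=
  PiTensorProduct.tprod ℝ f

variable (H) in
/-- The bilinear form on the algebraic tensor power that is determined by
`⟨f₁ ⊗ ⋯ ⊗ f_d, g₁ ⊗ ⋯ ⊗ g_d⟩ = ∏ k, ⟨f_k, g_k⟩`. -/
def algForm (d : ℕ) : AlgPower H d →ₗ[ℝ] AlgPower H d →ₗ[ℝ] ℝ :=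
  (PiTensorProduct.dualDistrib (R := ℝ) (M := fun _ : Fin d => H)) ∘ₗ
    (PiTensorProduct.map (fun _ : Fin d => innerₗ H))

theorem algForm_algTensor {d : ℕ} (f g : Fin d → H) :
    algForm H d (algTensor f) (algTensor g) = ∏ k, inner ℝ (f k) (g k) := by
  change PiTensorProduct.dualDistrib (PiTensorProduct.map (fun _ : Fin d => innerₗ H)
    (PiTensorProduct.tprod ℝ f)) (PiTensorProduct.tprod ℝ g) = _
  rw [PiTensorProduct.map_tprod, PiTensorProduct.dualDistrib_apply]
  rfl

theorem exists_eq_sum_algTensor {d : ℕ} (x : AlgPower H d) :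
    ∃ (m : ℕ) (c : Fin m → ℝ) (f : Fin m → Fin d → H), x = ∑ i, c i • algTensor (f i) := by
  refine PiTensorProduct.induction_on (R := ℝ) (s := fun _ : Fin d => H)
    (motive := fun x => ∃ (m : ℕ) (c : Fin m → ℝ) (f : Fin m → Fin d → H),
      (x : AlgPower H d) = ∑ i, c i • algTensor (f i)) x ?_ ?_
  · intro r f
    refine ⟨1, fun _ => r, fun _ => f, ?_⟩
    simp only [Fin.sum_univ_one]
    rfl
  · rintro x y ⟨m, c, f, hx⟩ ⟨m', c', f', hy⟩
    refine ⟨m + m', Fin.append c c', Fin.append f f', ?_⟩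
    rw [Fin.sum_univ_add]
    simp only [Fin.append_left, Fin.append_right]
    rw [← hx, ← hy]
    rfl

theorem algForm_symm {d : ℕ} (x y : AlgPower H d) : algForm H d x y = algForm H d y x := by
  obtain ⟨m, c, f, rfl⟩ := exists_eq_sum_algTensor x
  obtain ⟨m', c', f', rfl⟩ := exists_eq_sum_algTensor y
  simp only [map_sum, map_smul, LinearMap.sum_apply, LinearMap.smul_apply, smul_eq_mul,
    algForm_algTensor, Finset.mul_sum]
  rw [Finset.sum_comm]
  refine Finset.sum_congr rfl fun i _ => Finset.sum_congr rfl fun j _ => ?_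
  simp only [real_inner_comm]
  ring

/-- The entrywise product of Gram matrices. -/
theorem algForm_sum {d m : ℕ} (c : Fin m → ℝ) (f : Fin m → Fin d → H) :
    algForm H d (∑ i, c i • algTensor (f i)) (∑ i, c i • algTensor (f i)) =
      c ⬝ᵥ (Matrix.of fun i j => ∏ k, inner ℝ (f i k) (f j k)).mulVec c := by
  simp only [map_sum, map_smul, LinearMap.sum_apply, LinearMap.smul_apply, smul_eq_mul,
    algForm_algTensor, Finset.mul_sum, dotProduct, Matrix.mulVec, Matrix.of_apply]
  rw [Finset.sum_comm]
  refine Finset.sum_congr rfl fun i _ => Finset.sum_congr rfl fun j _ => ?_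
  ring

theorem posSemidef_prod_gram {ι : Type*} {m : ℕ} (t : Finset ι) (f : Fin m → ι → H) :
    (Matrix.of fun i j => ∏ k ∈ t, (inner ℝ (f i k) (f j k) : ℝ)).PosSemidef := by
  classical
  induction t using Finset.induction_on with
  | empty =>
    have h := Matrix.posSemidef_gram ℝ (fun _ : Fin m => (1 : ℝ))
    have e : (Matrix.of fun i j => ∏ k ∈ ∅, (inner ℝ (f i k) (f j k) : ℝ)) =
        Matrix.gram ℝ (fun _ : Fin m => (1 : ℝ)) := by
      ext i j
      simp [Matrix.gram]
    rw [e]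
    exact h
  | insert a t ha ih =>
    have h := (Matrix.posSemidef_gram ℝ (fun i => f i a)).hadamard ih
    have e : (Matrix.of fun i j => ∏ k ∈ insert a t, (inner ℝ (f i k) (f j k) : ℝ)) =
        (Matrix.gram ℝ fun i => f i a).hadamard
          (Matrix.of fun i j => ∏ k ∈ t, (inner ℝ (f i k) (f j k) : ℝ)) := by
      ext i j
      simp [Matrix.gram, Finset.prod_insert ha]
    rw [e]
    exact h

theorem posSemidef_prod_gram_sub (S : H →L[ℝ] G) {ι : Type*} {m : ℕ} (t : Finset ι)
    (f : Fin m → ι → H) :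
    ((Matrix.of fun i j => ∏ k ∈ t, (‖S‖ ^ 2 * inner ℝ (f i k) (f j k) : ℝ)) -
      Matrix.of fun i j => ∏ k ∈ t, (inner ℝ (S (f i k)) (S (f j k)) : ℝ)).PosSemidef := by
  classical
  induction t using Finset.induction_on with
  | empty =>
    have h : (0 : Matrix (Fin m) (Fin m) ℝ).PosSemidef := Matrix.PosSemidef.zero
    convert h using 1
    ext i j
    simp
  | insert a t ha ih =>
    have h1 := (Matrix.posSemidef_opNorm_smul_gram_sub_gram (𝕜 := ℝ) (fun i => f i a) S).hadamard
      ((posSemidef_prod_gram t f).smul (a := (‖S‖ ^ 2) ^ t.card) (by positivity))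
    have h2 := (Matrix.posSemidef_gram ℝ (fun i => S (f i a))).hadamard ih
    have h3 := h1.add h2
    have e : ((Matrix.of fun i j => ∏ k ∈ insert a t, (‖S‖ ^ 2 * inner ℝ (f i k) (f j k) : ℝ)) -
        Matrix.of fun i j => ∏ k ∈ insert a t, (inner ℝ (S (f i k)) (S (f j k)) : ℝ)) =
      ((‖S‖ ^ 2 • Matrix.gram ℝ fun i => f i a) - Matrix.gram ℝ (S ∘ fun i => f i a)).hadamard
        ((‖S‖ ^ 2) ^ t.card • Matrix.of fun i j => ∏ k ∈ t, (inner ℝ (f i k) (f j k) : ℝ)) +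
      (Matrix.gram ℝ fun i => S (f i a)).hadamard
        ((Matrix.of fun i j => ∏ k ∈ t, (‖S‖ ^ 2 * inner ℝ (f i k) (f j k) : ℝ)) -
          Matrix.of fun i j => ∏ k ∈ t, (inner ℝ (S (f i k)) (S (f j k)) : ℝ)) := by
      ext i j
      simp [Matrix.gram, Finset.prod_insert ha, Finset.prod_mul_distrib]
      ring
    rw [e]
    exact h3

theorem algForm_self_nonneg {d : ℕ} (x : AlgPower H d) : 0 ≤ algForm H d x x := by
  obtain ⟨m, c, f, rfl⟩ := exists_eq_sum_algTensor x
  rw [algForm_sum]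
  simpa using (posSemidef_prod_gram Finset.univ f).dotProduct_mulVec_nonneg c

variable (H) in
/-- The inner product of the algebraic tensor power, as a positive semidefinite symmetric form.
(It is in fact definite; the completion below is a Hilbert space without that information.) -/
@[reducible]
def algCore (d : ℕ) : PreInnerProductSpace.Core ℝ (AlgPower H d) where
  inner x y := algForm H d x y
  conj_inner_symm x y := by simpa using algForm_symm y x
  re_inner_nonneg x := by simpa using algForm_self_nonneg x
  add_left x y z := by simp
  smul_left x y r := by simp

instance (d : ℕ) : SeminormedAddCommGroup (AlgPower H d) :=
  InnerProductSpace.Core.toSeminormedAddCommGroup (𝕜 := ℝ) (c := algCore H d)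

instance (d : ℕ) : InnerProductSpace ℝ (AlgPower H d) :=
  InnerProductSpace.ofCore (algCore H d)

theorem inner_algTensor {d : ℕ} (f g : Fin d → H) :
    inner ℝ (algTensor f) (algTensor g) = ∏ k, inner ℝ (f k) (g k) :=
  algForm_algTensor f g

variable (H) in
/-- The `d`-fold Hilbert space tensor power `H_d` of `H`: the completion of the algebraic tensor
power with respect to the inner product above. -/
abbrev HilbertPower (d : ℕ) : Type _ := UniformSpace.Completion (AlgPower H d)

/-- The simple tensor `f₁ ⊗ ⋯ ⊗ f_d` as an element of the Hilbert space tensor power. -/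
def simpleTensor {d : ℕ} (f : Fin d → H) : HilbertPower H d := (algTensor f : AlgPower H d)

theorem inner_simpleTensor {d : ℕ} (f g : Fin d → H) :
    inner ℝ (simpleTensor f) (simpleTensor g) = ∏ k, inner ℝ (f k) (g k) := by
  rw [simpleTensor, simpleTensor, UniformSpace.Completion.inner_coe, inner_algTensor]

/-- The algebraic tensor power of a linear map. -/
def algMap (S : H →L[ℝ] G) (d : ℕ) : AlgPower H d →ₗ[ℝ] AlgPower G d :=
  PiTensorProduct.map (fun _ : Fin d => (S : H →ₗ[ℝ] G))

theorem algMap_algTensor (S : H →L[ℝ] G) {d : ℕ} (f : Fin d → H) :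
    algMap S d (algTensor f) = algTensor fun k => S (f k) := by
  unfold algMap algTensor
  erw [PiTensorProduct.map_tprod]
  rfl

theorem norm_algMap_le (S : H →L[ℝ] G) (d : ℕ) (x : AlgPower H d) :
    ‖algMap S d x‖ ≤ ‖S‖ ^ d * ‖x‖ := by
  refine le_of_sq_le_sq ?_ (by positivity)
  rw [mul_pow, ← real_inner_self_eq_norm_sq, ← real_inner_self_eq_norm_sq]
  change algForm G d (algMap S d x) (algMap S d x) ≤ _ * algForm H d x x
  obtain ⟨m, c, f, rfl⟩ := exists_eq_sum_algTensor x
  simp only [map_sum (algMap S d), map_smul (algMap S d), algMap_algTensor]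
  rw [algForm_sum c f, algForm_sum c (fun i k => S (f i k))]
  have h := (posSemidef_prod_gram_sub S Finset.univ f).dotProduct_mulVec_nonneg c
  rw [Matrix.sub_mulVec, dotProduct_sub, sub_nonneg] at h
  simp only [star_trivial] at h
  refine h.trans_eq ?_
  have e : (Matrix.of fun i j => ∏ k, (‖S‖ ^ 2 * inner ℝ (f i k) (f j k) : ℝ)) =
      ((‖S‖ ^ d) ^ 2) • (Matrix.of fun i j => ∏ k, (inner ℝ (f i k) (f j k) : ℝ)) := by
    ext i j
    simp [Finset.prod_mul_distrib, ← pow_mul, mul_comm]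
  rw [e, Matrix.smul_mulVec, dotProduct_smul, smul_eq_mul]

/-- The tensor product operator `S_d = S ⊗ ⋯ ⊗ S : H_d → G_d`: the continuous extension of the
algebraic tensor power of `S`. -/
def tensorOp (S : H →L[ℝ] G) (d : ℕ) : HilbertPower H d →L[ℝ] HilbertPower G d :=
  ((algMap S d).mkContinuous (‖S‖ ^ d) (norm_algMap_le S d)).completion

theorem tensorOp_simpleTensor (S : H →L[ℝ] G) {d : ℕ} (f : Fin d → H) :
    tensorOp S d (simpleTensor f) = simpleTensor fun k => S (f k) := by
  simp only [tensorOp, simpleTensor, ContinuousLinearMap.completion_apply_coe,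
    LinearMap.mkContinuous_apply, algMap_algTensor]

end TensorPower

/-! ### Scaled source spaces -/

section Scaled

variable (σ : Set.Ioi (0 : ℝ)) (E : Type*) [NormedAddCommGroup E] [InnerProductSpace ℝ E]

/-- The space `E`, equipped with the scaled inner product `⟨x, y⟩ / σ`. -/
def Scaled (_σ : Set.Ioi (0 : ℝ)) (E : Type*) : Type _ := E

instance : AddCommGroup (Scaled σ E) := inferInstanceAs (AddCommGroup E)

instance : Module ℝ (Scaled σ E) := inferInstanceAs (Module ℝ E)

/-- The identity, as a linear map from the scaled space to the original one. -/
def unscale : Scaled σ E →ₗ[ℝ] E := LinearMap.id (R := ℝ) (M := E)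

/-- The scaled inner product. -/
@[reducible]
def scaledCore : InnerProductSpace.Core ℝ (Scaled σ E) where
  inner x y := (σ : ℝ)⁻¹ * inner ℝ (unscale σ E x) (unscale σ E y)
  conj_inner_symm x y := by simp [real_inner_comm]
  re_inner_nonneg x := by
    have h : (0 : ℝ) < σ := σ.2
    have h' : 0 ≤ inner ℝ (unscale σ E x) (unscale σ E x) := real_inner_self_nonneg
    simpa using mul_nonneg (inv_nonneg.2 h.le) h'
  add_left x y z := by simp [inner_add_left, mul_add]
  smul_left x y r := by simp [inner_smul_left]; ring
  definite x hx := by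
    have h : ((σ : ℝ))⁻¹ ≠ 0 := inv_ne_zero (ne_of_gt σ.2)
    exact (inner_self_eq_zero (𝕜 := ℝ) (E := E)).1 ((mul_eq_zero.1 hx).resolve_left h)

instance : NormedAddCommGroup (Scaled σ E) :=
  InnerProductSpace.Core.toNormedAddCommGroup (𝕜 := ℝ) (cd := scaledCore σ E)

instance : InnerProductSpace ℝ (Scaled σ E) :=
  InnerProductSpace.ofCore (scaledCore σ E).toCore

theorem inner_scaled (x y : Scaled σ E) :
    inner ℝ x y = (σ : ℝ)⁻¹ * inner ℝ (unscale σ E x) (unscale σ E y) := rfl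

theorem norm_unscale (x : Scaled σ E) : ‖unscale σ E x‖ = √(σ : ℝ) * ‖x‖ := by
  have h : (0 : ℝ) < σ := σ.2
  rw [norm_eq_sqrt_real_inner x, inner_scaled, ← Real.sqrt_mul h.le,
    mul_inv_cancel_left₀ h.ne', ← norm_eq_sqrt_real_inner]

/-- The identity, as a continuous linear map from the scaled space to the original one. -/
def unscaleL : Scaled σ E →L[ℝ] E :=
  (unscale σ E).mkContinuous (√(σ : ℝ)) fun x => (norm_unscale σ E x).le

end Scaled

/-- The `d`-th operator `S_{d,s_d} : F_d → G_d` of the scaled tensor product problem: as a mapping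
it is `S_d`, but its source `F_d` is `H_d` with the inner product `⟨·,·⟩ / s_d`. -/
def scaledOp {H G : Type*} [NormedAddCommGroup H] [InnerProductSpace ℝ H]
    [NormedAddCommGroup G] [InnerProductSpace ℝ G]
    (S : H →L[ℝ] G) (s : ℕ → Set.Ioi (0 : ℝ)) (d : ℕ) :
    Scaled (s d) (HilbertPower H d) →L[ℝ] HilbertPower G d :=
  (tensorOp S d).comp (unscaleL (s d) (HilbertPower H d))

/-! ### Squared singular values -/

/-- The `n`-th largest eigenvalue (`n = 1, 2, …`) of `W = S† S`, counted with multiplicity, and `0`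
if there are fewer than `n` positive eigenvalues. It is the largest `t > 0` for which the
eigenspaces of `W` to eigenvalues `≥ t` have total dimension at least `n` (for compact `S` this
dimension is finite). -/
def sqSingularValue {H G : Type*} [NormedAddCommGroup H] [InnerProductSpace ℝ H] [CompleteSpace H]
    [NormedAddCommGroup G] [InnerProductSpace ℝ G] [CompleteSpace G]
    (S : H →L[ℝ] G) (n : ℕ) : ℝ :=
  sSup {t : ℝ | 0 < t ∧ n ≤ Module.finrank ℝ
    (⨆ μ : Set.Ici t, Module.End.eigenspace
      (((ContinuousLinearMap.adjoint S).comp S : H →L[ℝ] H) : Module.End ℝ H) (μ : ℝ) :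
      Submodule ℝ H)}

/-! ### Algorithms, worst case errors and information complexity -/

section Complexity

variable {F G : Type*} [NormedAddCommGroup F] [NormedSpace ℝ F]
  [NormedAddCommGroup G] [NormedSpace ℝ G]

/-- The two classes of algorithms: linear non-adaptive algorithms, and arbitrary algorithms that
use adaptively chosen continuous linear functionals. -/
inductive AlgorithmClass : Type
  | linear
  | adaptive

/-- Algorithms `f ↦ ∑ j, L_j(f) g_j` with `n` continuous linear functionals `L_j`. -/
def IsLinearAlgorithm (n : ℕ) (A : F → G) : Prop :=
  ∃ (L : Fin n → F →L[ℝ] ℝ) (g : Fin n → G), ∀ f, A f = ∑ j, L j f • g j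

/-- Algorithms `f ↦ φ(y₁, …, y_n)` with an arbitrary map `φ` and `y_j = L_j(f; y₁, …, y_{j-1})`,
where each `L_j(· ; y₁, …, y_{j-1})` is a continuous linear functional. -/
def IsAdaptiveAlgorithm (n : ℕ) (A : F → G) : Prop :=
  ∃ (L : (j : Fin n) → (Fin j → ℝ) → F →L[ℝ] ℝ) (φ : (Fin n → ℝ) → G), ∀ f,
    ∃ y : Fin n → ℝ, (∀ j : Fin n, y j = L j (fun i => y (Fin.castLE j.isLt.le i)) f) ∧ A f = φ y

/-- The algorithms of a class that use at most `n` information operations. -/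
def AlgorithmClass.algorithms (c : AlgorithmClass) (F G : Type*)
    [NormedAddCommGroup F] [NormedSpace ℝ F] [NormedAddCommGroup G] [NormedSpace ℝ G]
    (n : ℕ) : Set (F → G) :=
  match c with
  | .linear => {A | IsLinearAlgorithm n A}
  | .adaptive => {A | IsAdaptiveAlgorithm n A}

/-- The worst case error `sup ‖T f - A f‖` over the unit ball of `F`. -/
def worstCaseError (T A : F → G) : ℝ≥0∞ :=
  ⨆ f ∈ Metric.closedBall (0 : F) 1, ‖T f - A f‖ₑ

/-- The `n`-th minimal worst case error. -/
def minimalError (c : AlgorithmClass) (T : F → G) (n : ℕ) : ℝ≥0∞ :=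
  ⨅ A ∈ c.algorithms F G n, worstCaseError T A

/-- The information complexity for the absolute error criterion: the minimal `n` for which some
algorithm with `n` information operations has worst case error at most `ε`. (For a compact operator
between Hilbert spaces and `ε > 0` there is such an `n`.) -/
def absComplexity (c : AlgorithmClass) (T : F → G) (ε : ℝ≥0∞) : ℕ :=
  sInf {n : ℕ | ∃ A ∈ c.algorithms F G n, worstCaseError T A ≤ ε}

/-- The information complexity for the normalized error criterion: the error has to be reduced to
`ε` times the initial error. -/
def normComplexity (c : AlgorithmClass) (T : F → G) (ε : ℝ) : ℕ :=
  absComplexity c T (ENNReal.ofReal ε * minimalError c T 0)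

end Complexity

/-- The normalized information complexity `n(ε, d)` of the scaled tensor product problem. -/
def complexity {H G : Type*} [NormedAddCommGroup H] [InnerProductSpace ℝ H]
    [NormedAddCommGroup G] [InnerProductSpace ℝ G]
    (c : AlgorithmClass) (S : H →L[ℝ] G) (s : ℕ → Set.Ioi (0 : ℝ)) (ε : ℝ) (d : ℕ) : ℕ :=
  normComplexity c (scaledOp S s d) ε

/-! ### Tractability, for an information complexity `n(ε, d)`, `d = 1, 2, …` -/

/-- For some `ε > 0` there are `C, γ > 0` with `n(ε, d) ≥ C (1 + γ)^d` for infinitely many `d`. -/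
def CurseOfDimensionality (n : ℝ → ℕ → ℕ) : Prop :=
  ∃ ε > (0 : ℝ), ∃ C > (0 : ℝ), ∃ γ > (0 : ℝ), ∃ᶠ d : ℕ in atTop, C * (1 + γ) ^ d ≤ (n ε d : ℝ)

/-- `n(ε, d) ≤ C ε^{-p} d^q` for all `d` and all `ε ∈ (0, 1]`. -/
def PolynomiallyTractable (n : ℝ → ℕ → ℕ) : Prop :=
  ∃ C > (0 : ℝ), ∃ p > (0 : ℝ), ∃ q ≥ (0 : ℝ), ∀ d : ℕ, 1 ≤ d → ∀ ε ∈ Set.Ioc (0 : ℝ) 1,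
    (n ε d : ℝ) ≤ C * ε ^ (-p) * (d : ℝ) ^ q

/-- `ln n(ε, d) / (ε⁻¹ + d) → 0` as `ε⁻¹ + d → ∞`, for the normalized error criterion: the pairs
`(ε, d)` are those with `d ≥ 1` and `0 < ε < 1`, i.e. with an error demand below the initial
error. -/
def WeaklyTractable (n : ℝ → ℕ → ℕ) : Prop :=
  Tendsto (fun x : ℝ × ℕ => Real.log (n x.1 x.2) / (x.1⁻¹ + x.2))
    (comap (fun x : ℝ × ℕ => x.1⁻¹ + (x.2 : ℝ)) atTop ⊓
      𝓟 {x : ℝ × ℕ | 0 < x.1 ∧ x.1 < 1 ∧ 1 ≤ x.2})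
    (𝓝 0)

end

end ScaledTensor

/-! Everything reduces to counting eigenvalues. If a Hilbert basis diagonalizes `T† T`, spectral
truncation is optimal in both classes: an adaptive algorithm with `n` operations gives the same
output for `f` and `-f` on the common kernel of the functionals it uses after zero answers, and this
kernel meets the span of any `n + 1` eigenvectors. So the normalized complexity is the number of
eigenvalues above `ε²` times the largest one; a scaling factor multiplies error and initial error
alike and cancels (`Diagonalizes.normComplexity_eq`). Simple tensors of eigenvectors of `S† S`
diagonalize `S_d` with product eigenvalues (`Diagonalizes.tensorOp`), so `n(ε, d)` counts the tuples
in `largeTuples`.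

The rest is combinatorics. If `λ₁ = λ₂`, tuples with two values already give `2 ^ d`. For a suitable
fixed `ε`, tuples with exactly `k` non-maximal entries give `d.choose k`, which beats `d ^ q` for `k
> q`. The case `d = 1` of weak tractability forces `λ_n = o(ln⁻² n)`. Conversely, put `x_i = √(λ₁ /
σ i)`. A large tuple has `∏ x ≤ ε⁻¹`, and its non-maximal entries have `x ≥ √(λ₁ / λ₂) > 1`; hence
they are `O(ln ε⁻¹)` in number and their sum is `O(ε⁻¹)`. Weighting each such entry by `exp (-(a x +
z))` bounds the count (`log_ncard_largeTuples_le`), since the decay condition makes `∑ exp (-a x_i)`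
finite for every `a > 0`. -/

namespace ScaledTensor

/-! ### Operators diagonalized by a Hilbert basis -/

section Diagonalization

variable {E G : Type*} [NormedAddCommGroup E] [InnerProductSpace ℝ E]
  [NormedAddCommGroup G] [InnerProductSpace ℝ G]

/-- The Hilbert basis `b` consists of eigenvectors of `T† T` with eigenvalues `τ`. -/
def Diagonalizes {ι : Type*} (b : HilbertBasis ι ℝ E) (τ : ι → ℝ) (T : E →L[ℝ] G) : Prop :=
  ∀ i x, inner ℝ (T (b i)) (T x) = τ i * inner ℝ (b i) x

variable {ι : Type*} {b : HilbertBasis ι ℝ E} {τ : ι → ℝ} {T : E →L[ℝ] G}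

theorem Diagonalizes.eigenvalue_eq (h : Diagonalizes b τ T) (i : ι) : τ i = ‖T (b i)‖ ^ 2 := by
  have h1 := h i (b i)
  rw [real_inner_self_eq_norm_sq, real_inner_self_eq_norm_sq, b.orthonormal.1 i] at h1
  linarith

theorem Diagonalizes.nonneg (h : Diagonalizes b τ T) (i : ι) : 0 ≤ τ i := by
  rw [h.eigenvalue_eq]
  positivity

theorem hasSum_inner_sq (b : HilbertBasis ι ℝ E) (x : E) :
    HasSum (fun i => inner ℝ (b i) x ^ 2) (‖x‖ ^ 2) := by
  have h := b.hasSum_inner_mul_inner x x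
  rw [real_inner_self_eq_norm_sq] at h
  refine h.congr_fun fun i => ?_
  rw [real_inner_comm x, sq]

theorem Diagonalizes.hasSum_norm_sq (h : Diagonalizes b τ T) (x : E) :
    HasSum (fun i => τ i * inner ℝ (b i) x ^ 2) (‖T x‖ ^ 2) := by
  have h1 := (b.hasSum_repr x).mapL ((innerSL ℝ (T x)).comp T)
  simp only [ContinuousLinearMap.comp_apply, innerSL_apply_apply, map_smul,
    real_inner_self_eq_norm_sq, b.repr_apply_apply] at h1
  refine h1.congr_fun fun i => ?_
  rw [real_inner_comm (T (b i)), h i x, smul_eq_mul]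
  ring

theorem Diagonalizes.norm_sq_le (h : Diagonalizes b τ T) {t : ℝ} {x : E}
    (hx : ∀ i, t < τ i → inner ℝ (b i) x = 0) : ‖T x‖ ^ 2 ≤ t * ‖x‖ ^ 2 := by
  refine hasSum_le (fun i => ?_) (h.hasSum_norm_sq x) ((hasSum_inner_sq b x).mul_left t)
  rcases lt_or_ge t (τ i) with hi | hi
  · simp [hx i hi]
  · exact mul_le_mul_of_nonneg_right hi (sq_nonneg _)

theorem Diagonalizes.le_norm_sq (h : Diagonalizes b τ T) {t : ℝ} {x : E}
    (hx : ∀ i, τ i < t → inner ℝ (b i) x = 0) : t * ‖x‖ ^ 2 ≤ ‖T x‖ ^ 2 := by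
  refine hasSum_le (fun i => ?_) ((hasSum_inner_sq b x).mul_left t) (h.hasSum_norm_sq x)
  rcases lt_or_ge (τ i) t with hi | hi
  · simp [hx i hi]
  · exact mul_le_mul_of_nonneg_right hi (sq_nonneg _)

end Diagonalization

/-! ### Adaptive algorithms and zero information -/

section Algorithms

variable {F G : Type*} [NormedAddCommGroup F] [NormedSpace ℝ F]
  [NormedAddCommGroup G] [NormedSpace ℝ G]

theorem IsLinearAlgorithm.isAdaptiveAlgorithm {n : ℕ} {A : F → G} (h : IsLinearAlgorithm n A) :
    IsAdaptiveAlgorithm n A := by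
  obtain ⟨L, g, h⟩ := h
  exact ⟨fun j _ => L j, fun y => ∑ j, y j • g j, fun f => ⟨fun j => L j f, fun j => rfl, h f⟩⟩

theorem mem_algorithms_of_isLinearAlgorithm (c : AlgorithmClass) {n : ℕ} {A : F → G}
    (h : IsLinearAlgorithm n A) : A ∈ c.algorithms F G n := by
  cases c
  · exact h
  · exact h.isAdaptiveAlgorithm

theorem isAdaptiveAlgorithm_of_mem_algorithms {c : AlgorithmClass} {n : ℕ} {A : F → G}
    (h : A ∈ c.algorithms F G n) : IsAdaptiveAlgorithm n A := by
  cases c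
  · exact IsLinearAlgorithm.isAdaptiveAlgorithm h
  · exact h

omit [NormedAddCommGroup G] [NormedSpace ℝ G] in
/-- An adaptive algorithm is constant on the common kernel of the functionals that it uses
for the zero input. -/
theorem IsAdaptiveAlgorithm.exists_functionals {n : ℕ} {A : F → G} (h : IsAdaptiveAlgorithm n A) :
    ∃ (L : Fin n → F →L[ℝ] ℝ) (a : G), ∀ f, (∀ j, L j f = 0) → A f = a := by
  obtain ⟨L, φ, h⟩ := h
  refine ⟨fun j => L j 0, φ 0, fun f hf => ?_⟩
  obtain ⟨y, hy, hA⟩ := h f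
  -- Zero answers reproduce themselves: if all earlier answers vanish, the next functional is the
  -- one chosen for zero answers, and it kills `f`.
  have hy0 : ∀ (m : ℕ) (hm : m < n), y ⟨m, hm⟩ = 0 := by
    intro m
    induction m using Nat.strong_induction_on with
    | _ m ih =>
      intro hm
      rw [hy ⟨m, hm⟩]
      have e : (fun i : Fin m => y (Fin.castLE hm.le i)) = 0 := by
        funext i
        exact ih i i.2 _
      change L ⟨m, hm⟩ (fun i : Fin m => y (Fin.castLE hm.le i)) f = 0
      rw [e]
      exact hf ⟨m, hm⟩
  have e : y = 0 := funext fun j => hy0 j j.2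
  rw [hA, e]

/-- Both `f` and `-f` lie in the kernel and receive the same output `a`. As `2 T f = (T f - a) - (T
(-f) - a)`, one of the two errors is at least `‖T f‖`. -/
theorem enorm_le_worstCaseError {c : AlgorithmClass} {n : ℕ} {A : F → G}
    (hA : A ∈ c.algorithms F G n) (T : F →L[ℝ] G) :
    ∃ L : Fin n → F →L[ℝ] ℝ, ∀ f, (∀ j, L j f = 0) → ‖f‖ ≤ 1 →
      ‖T f‖ₑ ≤ worstCaseError T A := by
  obtain ⟨L, a, h⟩ := (isAdaptiveAlgorithm_of_mem_algorithms hA).exists_functionals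
  refine ⟨L, fun f hf hf1 => ?_⟩
  have h1 : ‖T f - a‖ₑ ≤ worstCaseError T A := by
    rw [← h f hf]
    exact le_iSup₂_of_le f (by simpa using hf1) le_rfl
  have h2 : ‖T (-f) - a‖ₑ ≤ worstCaseError T A := by
    rw [← h (-f) (by simpa using hf)]
    exact le_iSup₂_of_le (-f) (by simpa using hf1) le_rfl
  have key : ‖T f‖ ≤ max ‖T f - a‖ ‖T (-f) - a‖ := by
    have e : (2 : ℝ) • T f = (T f - a) - (T (-f) - a) := by
      rw [map_neg, two_smul]
      abel
    have h3 := norm_sub_le (T f - a) (T (-f) - a)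
    rw [← e, norm_smul, Real.norm_ofNat] at h3
    have := le_max_left ‖T f - a‖ ‖T (-f) - a‖
    have := le_max_right ‖T f - a‖ ‖T (-f) - a‖
    linarith
  rcases le_max_iff.1 key with h3 | h3
  · exact (enorm_le_iff_norm_le.2 h3).trans h1
  · exact (enorm_le_iff_norm_le.2 h3).trans h2

end Algorithms

/-! ### Minimal errors and complexity in terms of eigenvalues -/

section ErrorOfDiagonalized

variable {F E G : Type*} [NormedAddCommGroup F] [NormedSpace ℝ F]
  [NormedAddCommGroup E] [InnerProductSpace ℝ E]
  [NormedAddCommGroup G] [InnerProductSpace ℝ G]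
  {ι : Type*} {b : HilbertBasis ι ℝ E} {τ : ι → ℝ} {T : E →L[ℝ] G}

theorem exists_ne_zero_of_lt_card {V : Type*} [AddCommGroup V] [Module ℝ V] {n : ℕ}
    {N : Finset ι} (hn : n < N.card) {e : ι → V} (he : LinearIndependent ℝ e)
    (L : Fin n → V →ₗ[ℝ] ℝ) :
    ∃ v ∈ Submodule.span ℝ (e '' N), v ≠ 0 ∧ ∀ j, L j v = 0 := by
  classical
  let Φ : (N → ℝ) →ₗ[ℝ] V := Fintype.linearCombination ℝ (fun i : N => e i)
  have hinj : Function.Injective Φ :=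
    (he.comp (fun i : N => (i : ι)) Subtype.val_injective).fintypeLinearCombination_injective
  have hker : LinearMap.ker ((LinearMap.pi L).comp Φ) ≠ ⊥ := by
    apply LinearMap.ker_ne_bot_of_finrank_lt
    simpa using hn
  obtain ⟨c, hc, hc0⟩ := (Submodule.ne_bot_iff _).1 hker
  refine ⟨Φ c, ?_, fun h => hc0 (hinj (h.trans (map_zero Φ).symm)), fun j => ?_⟩
  · rw [Fintype.linearCombination_apply]
    exact Submodule.sum_mem _ fun i _ => Submodule.smul_mem _ _
      (Submodule.subset_span ⟨i, i.2, rfl⟩)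
  · exact congrFun (LinearMap.mem_ker.1 hc) j

theorem inner_eq_zero_of_mem_span (b : HilbertBasis ι ℝ E) {N : Set ι} {i : ι} (hi : i ∉ N) {v : E}
    (hv : v ∈ Submodule.span ℝ (b '' N)) : inner ℝ (b i) v = 0 := by
  induction hv using Submodule.span_induction with
  | mem x hx =>
    obtain ⟨j, hj, rfl⟩ := hx
    exact b.orthonormal.2 fun hij => hi (hij ▸ hj)
  | zero => exact inner_zero_right _
  | add x y _ _ hx hy => rw [inner_add_right, hx, hy, add_zero]
  | smul a x _ hx => rw [inner_smul_right, hx, mul_zero]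

/-- Among more than `n` eigenvectors, some nonzero combination has zero information, and `T`
stretches it by at least `√t`. The map `U` stands for the change of norm on the source. -/
theorem Diagonalizes.le_worstCaseError (h : Diagonalizes b τ T) (U : F →L[ℝ] E)
    (hU : Function.Surjective U) {r : ℝ} (hr : 0 < r) (hUr : ∀ f, ‖U f‖ = r * ‖f‖)
    {c : AlgorithmClass} {n : ℕ} {A : F → G} (hA : A ∈ c.algorithms F G n) {N : Finset ι}
    (hn : n < N.card) {t : ℝ} (ht : 0 ≤ t) (hN : ∀ i ∈ N, t ≤ τ i) :
    ENNReal.ofReal (r * √t) ≤ worstCaseError (T.comp U) A := by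
  classical
  obtain ⟨L, hL⟩ := enorm_le_worstCaseError hA (T.comp U)
  have hUinj : Function.Injective U := by
    refine (injective_iff_map_eq_zero U).2 fun f hf => ?_
    have := hUr f
    rw [hf, norm_zero, eq_comm, mul_eq_zero] at this
    exact norm_eq_zero.1 (this.resolve_left hr.ne')
  let V : F ≃ₗ[ℝ] E := LinearEquiv.ofBijective (U : F →ₗ[ℝ] E) ⟨hUinj, hU⟩
  obtain ⟨v, hv, hv0, hLv⟩ := exists_ne_zero_of_lt_card hn b.orthonormal.linearIndependent
    (fun j => ((L j : F →ₗ[ℝ] ℝ)).comp (V.symm : E →ₗ[ℝ] F))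
  have hUV : ∀ w, U (V.symm w) = w := fun w => V.apply_symm_apply w
  -- The factor gives `‖U f‖ = r`, hence `‖f‖ = 1`.
  set f : F := (r / ‖v‖) • V.symm v with hf
  have hv1 : 0 < ‖v‖ := norm_pos_iff.2 hv0
  have hUf : U f = (r / ‖v‖) • v := by rw [hf, map_smul, hUV]
  have hUfn : ‖U f‖ = r := by
    rw [hUf, norm_smul, Real.norm_eq_abs, abs_of_pos (by positivity)]
    field_simp
  have hfn : ‖f‖ = 1 := by
    have h1 := hUr f
    rw [hUfn] at h1
    exact mul_left_cancel₀ hr.ne' (by linarith)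
  have hLf : ∀ j, L j f = 0 := fun j => by
    rw [hf, map_smul, smul_eq_zero]
    exact Or.inr (hLv j)
  have hcoeff : ∀ i, τ i < t → inner ℝ (b i) (U f) = 0 := by
    intro i hi
    have hiN : i ∉ N := fun hiN => absurd (hN i hiN) (not_le.2 hi)
    rw [hUf, inner_smul_right, inner_eq_zero_of_mem_span b hiN hv, mul_zero]
  refine le_trans ?_ (hL f hLf hfn.le)
  rw [← ofReal_norm]
  refine ENNReal.ofReal_le_ofReal (le_of_sq_le_sq ?_ (norm_nonneg _))
  have h1 := h.le_norm_sq hcoeff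
  rw [hUfn] at h1
  rw [mul_pow, Real.sq_sqrt ht, mul_comm]
  exact h1

/-- Applying `T` to the truncated basis expansion leaves an error supported on eigenvalues at most
`t`. -/
theorem Diagonalizes.exists_linearAlgorithm (h : Diagonalizes b τ T) (U : F →L[ℝ] E)
    {r : ℝ} (hr : 0 < r) (hUr : ∀ f, ‖U f‖ = r * ‖f‖) {t : ℝ} (ht : 0 ≤ t) {N : Finset ι}
    (hN : ∀ i, t < τ i → i ∈ N) :
    ∃ A : F → G, IsLinearAlgorithm N.card A ∧
      worstCaseError (T.comp U) A ≤ ENNReal.ofReal (r * √t) := by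
  classical
  let P : E → E := fun x => ∑ i ∈ N, inner ℝ (b i) x • b i
  refine ⟨fun f => T (P (U f)), ⟨fun j => (innerSL ℝ (b (N.equivFin.symm j))).comp U,
    fun j => T (b (N.equivFin.symm j)), fun f => ?_⟩, iSup₂_le fun f hf => ?_⟩
  · simp only [P, map_sum, map_smul, ContinuousLinearMap.comp_apply, innerSL_apply_apply]
    rw [← Finset.sum_coe_sort]
    exact (Equiv.sum_comp N.equivFin.symm
      fun i : N => inner ℝ (b i) (U f) • T (b i)).symm
  · have hP : ∀ i, inner ℝ (b i) (U f - P (U f)) = if i ∈ N then 0 else inner ℝ (b i) (U f) := by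
      intro i
      simp only [P, inner_sub_right, inner_sum, inner_smul_right,
        orthonormal_iff_ite.1 b.orthonormal, mul_ite, mul_one, mul_zero, Finset.sum_ite_eq]
      split_ifs <;> simp
    have h1 : ‖T (U f - P (U f))‖ ^ 2 ≤ t * ‖U f - P (U f)‖ ^ 2 :=
      h.norm_sq_le fun i hi => by rw [hP, if_pos (hN i hi)]
    have h2 : ‖U f - P (U f)‖ ^ 2 ≤ ‖U f‖ ^ 2 := by
      refine hasSum_le (fun i => ?_) (hasSum_inner_sq b _) (hasSum_inner_sq b _)
      rw [hP]
      split_ifs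
      · simpa using sq_nonneg _
      · exact le_rfl
    have h3 : ‖U f‖ ≤ r := by
      rw [hUr]
      exact mul_le_of_le_one_right hr.le (by simpa using hf)
    rw [ContinuousLinearMap.comp_apply, ← map_sub, ← ofReal_norm]
    refine ENNReal.ofReal_le_ofReal (le_of_sq_le_sq ?_ (by positivity))
    rw [mul_pow, Real.sq_sqrt ht]
    calc ‖T (U f - P (U f))‖ ^ 2 ≤ t * ‖U f - P (U f)‖ ^ 2 := h1
      _ ≤ t * r ^ 2 := mul_le_mul_of_nonneg_left (h2.trans (by gcongr)) ht
      _ = r ^ 2 * t := mul_comm _ _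

theorem Diagonalizes.minimalError_zero (h : Diagonalizes b τ T) (U : F →L[ℝ] E)
    (hU : Function.Surjective U) {r : ℝ} (hr : 0 < r) (hUr : ∀ f, ‖U f‖ = r * ‖f‖)
    (c : AlgorithmClass) {i₀ : ι} (hmax : ∀ i, τ i ≤ τ i₀) :
    minimalError c (T.comp U) 0 = ENNReal.ofReal (r * √(τ i₀)) := by
  refine le_antisymm ?_ (le_iInf₂ fun A hA => ?_)
  · obtain ⟨A, hA, hA1⟩ := h.exists_linearAlgorithm U hr hUr (h.nonneg i₀) (N := ∅)
      fun i hi => absurd (hmax i) (not_le.2 hi)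
    exact iInf₂_le_of_le A (mem_algorithms_of_isLinearAlgorithm c hA) hA1
  · exact h.le_worstCaseError U hU hr hUr hA (N := {i₀}) (by simp) (h.nonneg i₀) (by simp)

/-- The information complexity is the number of eigenvalues above the threshold. -/
theorem Diagonalizes.normComplexity_eq (h : Diagonalizes b τ T) (U : F →L[ℝ] E)
    (hU : Function.Surjective U) {r : ℝ} (hr : 0 < r) (hUr : ∀ f, ‖U f‖ = r * ‖f‖)
    (c : AlgorithmClass) {i₀ : ι} (hmax : ∀ i, τ i ≤ τ i₀) {ε : ℝ} (hε : 0 < ε)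
    (hfin : {i | ε ^ 2 * τ i₀ < τ i}.Finite) :
    normComplexity c (T.comp U) ε = {i | ε ^ 2 * τ i₀ < τ i}.ncard := by
  have ht : 0 ≤ ε ^ 2 * τ i₀ := mul_nonneg (sq_nonneg _) (h.nonneg i₀)
  have herr : ENNReal.ofReal ε * minimalError c (T.comp U) 0 =
      ENNReal.ofReal (r * √(ε ^ 2 * τ i₀)) := by
    rw [h.minimalError_zero U hU hr hUr c hmax, ← ENNReal.ofReal_mul hε.le,
      Real.sqrt_mul (sq_nonneg _), Real.sqrt_sq hε.le]
    congr 1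
    ring
  rw [normComplexity, absComplexity, herr, Set.ncard_eq_toFinset_card _ hfin]
  refine le_antisymm (Nat.sInf_le ?_) (le_csInf ?_ ?_)
  · obtain ⟨A, hA, hA1⟩ := h.exists_linearAlgorithm U hr hUr ht (N := hfin.toFinset) (by simp)
    exact ⟨A, mem_algorithms_of_isLinearAlgorithm c hA, hA1⟩
  -- Nonemptiness matters: the infimum of the empty set of naturals would be `0`.
  · obtain ⟨A, hA, hA1⟩ := h.exists_linearAlgorithm U hr hUr ht (N := hfin.toFinset) (by simp)
    exact ⟨_, A, mem_algorithms_of_isLinearAlgorithm c hA, hA1⟩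
  · rintro n ⟨A, hA, hA1⟩
    by_contra! hn
    have hne : hfin.toFinset.Nonempty := Finset.card_pos.1 (by omega)
    -- The smallest of these finitely many eigenvalues is still strictly above the threshold, so the
    -- lower bound strictly exceeds the permitted error.
    obtain ⟨j, hj, hjmin⟩ := hfin.toFinset.exists_min_image τ hne
    have h1 := h.le_worstCaseError U hU hr hUr hA hn (h.nonneg j) hjmin
    have h2 : ε ^ 2 * τ i₀ < τ j := by simpa using hj
    refine absurd (h1.trans hA1) (not_le.2 ?_)
    have hj0 : 0 < τ j := ht.trans_lt h2
    refine (ENNReal.ofReal_lt_ofReal_iff (by positivity)).2 ?_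
    gcongr

end ErrorOfDiagonalized

universe u

/-! ### Spectral theorem and the ordered eigenvalues -/

section Spectral

variable {H : Type u} {G : Type*} [NormedAddCommGroup H] [InnerProductSpace ℝ H] [CompleteSpace H]
  [NormedAddCommGroup G] [InnerProductSpace ℝ G] [CompleteSpace G]

omit [CompleteSpace H] in
theorem orthogonal_span_sigma_eq_bot {κ : Type*} {V : κ → Submodule ℝ H} (hV : (⨆ k, V k)ᗮ = ⊥)
    {α : κ → Type*} (w : ∀ k, HilbertBasis (α k) ℝ (V k)) :
    (Submodule.span ℝ (Set.range fun a : Σ k, α k => ((w a.1 a.2 : V a.1) : H)))ᗮ = ⊥ := by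
  rw [eq_bot_iff, ← hV]
  intro x hx
  rw [Submodule.mem_orthogonal] at hx
  rw [Submodule.mem_orthogonal]
  intro u hu
  induction hu using Submodule.iSup_induction' with
  | mem k u hu =>
    have h1 := ((w k).hasSum_repr ⟨u, hu⟩).mapL ((innerSL ℝ x).comp (V k).subtypeL)
    have h2 : ∀ i, (innerSL ℝ x).comp (V k).subtypeL ((w k).repr ⟨u, hu⟩ i • w k i) = 0 := by
      intro i
      have h3 := hx _ (Submodule.subset_span ⟨⟨k, i⟩, rfl⟩)
      rw [map_smul, smul_eq_zero]
      right
      rw [real_inner_comm] at h3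
      exact h3
    simp only [h2] at h1
    have h3 := h1.unique hasSum_zero
    rw [real_inner_comm]
    exact h3
  | zero => exact inner_zero_left _
  | add u v _ _ hu hv => rw [inner_add_left, hu, hv, add_zero]

/-- The union of bases of the summands is orthonormal and total. Taking `κ` in `Type` keeps the
index type in the universe of `H`. -/
theorem exists_hilbertBasis_of_orthogonalFamily {κ : Type} (V : κ → Submodule ℝ H)
    [∀ k, CompleteSpace (V k)]
    (hort : OrthogonalFamily ℝ (fun k => V k) fun k => (V k).subtypeₗᵢ) (hV : (⨆ k, V k)ᗮ = ⊥) :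
    ∃ (ι : Type u) (b : HilbertBasis ι ℝ H) (k : ι → κ), ∀ i, b i ∈ V (k i) := by
  choose w bw hbw using fun k => exists_hilbertBasis ℝ (V k)
  have h1 : Orthonormal ℝ fun a : Σ k, w k => ((bw a.1 a.2 : V a.1) : H) :=
    hort.orthonormal_sigma_orthonormal fun k => (bw k).orthonormal
  have h2 := orthogonal_span_sigma_eq_bot hV bw
  refine ⟨Σ k, w k, HilbertBasis.mkOfOrthogonalEqBot h1 h2, fun a => a.1, fun a => ?_⟩
  rw [HilbertBasis.coe_mkOfOrthogonalEqBot]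
  exact (bw a.1 a.2).2

/-- The spectral theorem for compact symmetric operators. -/
theorem exists_hilbertBasis_eigenvectors {W : H →L[ℝ] H} (hW : IsCompactOperator W)
    (hsymm : W.IsSymmetric) :
    ∃ (ι : Type u) (b : HilbertBasis ι ℝ H) (σ : ι → ℝ), ∀ i, W (b i) = σ i • b i := by
  have hcs : ∀ μ : ℝ, CompleteSpace (Module.End.eigenspace (W : Module.End ℝ H) μ) := fun μ => by
    have e : (Module.End.eigenspace (W : Module.End ℝ H) μ : Set H) = {x | W x = μ • x} := by
      ext x
      exact Module.End.mem_eigenspace_iff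
    refine IsClosed.completeSpace_coe (s := (Module.End.eigenspace (W : Module.End ℝ H) μ : Set H))
      (hs := ?_)
    rw [e]
    exact isClosed_eq W.continuous (continuous_const_smul μ)
  obtain ⟨ι, b, σ, h⟩ := exists_hilbertBasis_of_orthogonalFamily
    (fun μ : ℝ => Module.End.eigenspace (W : Module.End ℝ H) μ)
    hsymm.orthogonalFamily_eigenspaces
    (ContinuousLinearMap.orthogonalComplement_iSup_eigenspaces_eq_bot hW hsymm)
  exact ⟨ι, b, σ, fun i => Module.End.mem_eigenspace_iff.1 (h i)⟩

theorem exists_diagonalizes {S : H →L[ℝ] G} (hS : IsCompactOperator S) :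
    ∃ (ι : Type u) (b : HilbertBasis ι ℝ H) (σ : ι → ℝ), Diagonalizes b σ S := by
  obtain ⟨ι, b, σ, h⟩ := exists_hilbertBasis_eigenvectors
    (W := (ContinuousLinearMap.adjoint S).comp S) (hS.clm_comp (ContinuousLinearMap.adjoint S))
    fun x y => by
      change inner ℝ ((ContinuousLinearMap.adjoint S) (S x)) y =
        inner ℝ x ((ContinuousLinearMap.adjoint S) (S y))
      rw [ContinuousLinearMap.adjoint_inner_left, ContinuousLinearMap.adjoint_inner_right]
  refine ⟨ι, b, σ, fun i x => ?_⟩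
  rw [← ContinuousLinearMap.adjoint_inner_left, ← real_inner_smul_left, ← h i]
  rfl

variable {S : H →L[ℝ] G} {ι : Type*} {b : HilbertBasis ι ℝ H} {σ : ι → ℝ}

omit [CompleteSpace H] [CompleteSpace G] in
-- The images of distinct basis vectors are orthogonal, at squared distance `σ i + σ j`. Infinitely
-- many eigenvalues `≥ t` would yield a bounded sequence whose images have no Cauchy subsequence.
theorem Diagonalizes.finite_superlevel (h : Diagonalizes b σ S) (hS : IsCompactOperator S) {t : ℝ}
    (ht : 0 < t) : {i | t ≤ σ i}.Finite := by
  by_contra hinf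
  have hinf : {i | t ≤ σ i}.Infinite := hinf
  let e : ℕ ↪ {i | t ≤ σ i} := hinf.natEmbedding
  have hK := hS.isCompact_closure_image_closedBall (𝕜₁ := ℝ) 1
  obtain ⟨a, -, φ, hφ, ha⟩ := hK.tendsto_subseq (x := fun n => S (b (e n))) fun n =>
    subset_closure ⟨b (e n), by simp [b.orthonormal.1], rfl⟩
  have hcau := ha.cauchySeq
  rw [Metric.cauchySeq_iff'] at hcau
  obtain ⟨N, hN⟩ := hcau (√t) (Real.sqrt_pos.2 ht)
  have h1 := hN (N + 1) (Nat.le_succ N)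
  have hne : ((e (φ (N + 1)) : {i | t ≤ σ i}) : ι) ≠ e (φ N) := fun heq =>
    (hφ (Nat.lt_succ_self N)).ne' (e.injective (Subtype.ext heq))
  simp only [Function.comp_apply, dist_eq_norm] at h1
  have h2 : ‖S (b (e (φ (N + 1)))) - S (b (e (φ N)))‖ ^ 2 =
      σ (e (φ (N + 1))) + σ (e (φ N)) := by
    rw [@norm_sub_sq_real, h, b.orthonormal.2 hne, h.eigenvalue_eq, h.eigenvalue_eq]
    ring
  have h3 : ‖S (b (e (φ (N + 1)))) - S (b (e (φ N)))‖ ^ 2 < √t ^ 2 := by gcongr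
  rw [Real.sq_sqrt ht.le, h2] at h3
  have h4 : t ≤ σ (e (φ (N + 1))) := (e (φ (N + 1))).2
  have h5 := h.nonneg (e (φ N))
  linarith

/-- An eigenvector to `μ` has components only where `σ i = μ`; by finiteness its expansion is a
finite sum, so no closure of the span is needed. -/
theorem Diagonalizes.iSup_eigenspace (h : Diagonalizes b σ S) {t : ℝ}
    (hfin : {i | t ≤ σ i}.Finite) :
    (⨆ μ : Set.Ici t, Module.End.eigenspace
      (((ContinuousLinearMap.adjoint S).comp S : H →L[ℝ] H) : Module.End ℝ H) (μ : ℝ)) =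
      Submodule.span ℝ (b '' {i | t ≤ σ i}) := by
  have hev : ∀ i, (ContinuousLinearMap.adjoint S) (S (b i)) = σ i • b i := fun i => by
    refine ext_inner_right ℝ fun x => ?_
    rw [ContinuousLinearMap.adjoint_inner_left, h, real_inner_smul_left]
  refine le_antisymm (iSup_le fun μ x hx => ?_) (Submodule.span_le.2 ?_)
  · have hx' : (ContinuousLinearMap.adjoint S) (S x) = (μ : ℝ) • x :=
      Module.End.mem_eigenspace_iff.1 hx
    have h0 : ∀ i, ¬ t ≤ σ i → b.repr x i = 0 := by
      intro i hi
      rw [b.repr_apply_apply]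
      have h1 := h i x
      rw [← ContinuousLinearMap.adjoint_inner_right, hx', real_inner_smul_right] at h1
      have h2 : (μ : ℝ) - σ i ≠ 0 := fun h3 => hi (by have h4 : t ≤ μ := μ.2; linarith)
      exact (mul_eq_zero.1 (by linarith : ((μ : ℝ) - σ i) * inner ℝ (b i) x = 0)).resolve_left h2
    have h1 : HasSum (fun i => b.repr x i • b i) (∑ i ∈ hfin.toFinset, b.repr x i • b i) :=
      hasSum_sum_of_ne_finset_zero fun i hi => by
        rw [h0 i (by simpa using hi), zero_smul]
    rw [(b.hasSum_repr x).unique h1]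
    exact Submodule.sum_mem _ fun i hi => Submodule.smul_mem _ _
      (Submodule.subset_span ⟨i, by simpa using hi, rfl⟩)
  · rintro _ ⟨i, hi, rfl⟩
    exact Submodule.mem_iSup_of_mem (⟨σ i, hi⟩ : Set.Ici t)
      (Module.End.mem_eigenspace_iff.2 (hev i))

theorem Diagonalizes.sqSingularValue_eq (h : Diagonalizes b σ S)
    (hfin : ∀ t, 0 < t → {i | t ≤ σ i}.Finite) (n : ℕ) :
    sqSingularValue S n = sSup {t : ℝ | 0 < t ∧ n ≤ {i | t ≤ σ i}.ncard} := by
  rw [sqSingularValue]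
  congr 1
  ext t
  refine and_congr_right fun ht => ?_
  rw [h.iSup_eigenspace (hfin t ht)]
  have hf := hfin t ht
  have : Fintype {i | t ≤ σ i} := hf.fintype
  have e := finrank_span_eq_card (R := ℝ) (b := fun i : {i | t ≤ σ i} => b i)
    (b.orthonormal.linearIndependent.comp _ Subtype.val_injective)
  rw [Set.image_eq_range, e, Set.ncard_eq_toFinset_card', Set.toFinset_card]

/-- The eigenvalues cannot accumulate at a positive number, so the counting function is constant
just to the left of `t`. The bound `1 ≤ n` makes the set bounded above. -/
theorem le_sSup_superlevel_iff {ι : Type*} {σ : ι → ℝ} (hfin : ∀ t, 0 < t → {i | t ≤ σ i}.Finite)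
    {n : ℕ} (hn : 1 ≤ n) {t : ℝ} (ht : 0 < t) :
    t ≤ sSup {t : ℝ | 0 < t ∧ n ≤ {i | t ≤ σ i}.ncard} ↔ n ≤ {i | t ≤ σ i}.ncard := by
  constructor
  · contrapose!
    intro hlt
    -- Take `s` so close to `t` that no eigenvalue lies in `[s, t)`; then no `u > s` can belong to
    -- the set.
    have hev : ∀ᶠ s in 𝓝[<] t, ∀ i ∈ {i | t / 2 ≤ σ i}, σ i < t → σ i < s := by
      rw [(hfin (t / 2) (by positivity)).eventually_all]
      intro i _
      by_cases hi : σ i < t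
      · filter_upwards [Ioo_mem_nhdsLT hi] with s hs _ using hs.1
      · exact Eventually.of_forall fun s h => absurd h hi
    obtain ⟨s, hs, hs1, hs2⟩ := (hev.and (Ioo_mem_nhdsLT (half_lt_self ht))).exists
    refine lt_of_le_of_lt (Real.sSup_le ?_ (by linarith)) hs2
    rintro u ⟨hu0, hu⟩
    by_contra! hsu
    refine absurd (hu.trans (Set.ncard_le_ncard (fun i hi => ?_) (hfin t ht))) (not_le.2 hlt)
    have hi' : u ≤ σ i := hi
    by_contra hti
    have := hs i (by simp only [Set.mem_ofPred_eq]; linarith) (not_le.1 hti)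
    linarith
  · intro h
    obtain ⟨M, hM⟩ := ((hfin t ht).image σ).bddAbove
    refine le_csSup ⟨max t M, ?_⟩ ⟨ht, h⟩
    rintro u ⟨hu0, hu⟩
    rcases le_total u t with hut | hut
    · exact hut.trans (le_max_left _ _)
    · obtain ⟨i, hi⟩ := Set.nonempty_of_ncard_ne_zero (s := {i | u ≤ σ i}) (by omega)
      exact (le_trans hi (hM ⟨i, le_trans hut hi, rfl⟩)).trans (le_max_right _ _)

end Spectral

/-! ### Eigenbasis of the tensor power -/

section TensorBasis

variable {H G : Type*} [NormedAddCommGroup H] [InnerProductSpace ℝ H]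
  [NormedAddCommGroup G] [InnerProductSpace ℝ G]

theorem hilbertPower_functional_ext {d : ℕ} {φ ψ : HilbertPower H d →L[ℝ] ℝ}
    (h : ∀ f : Fin d → H, φ (simpleTensor f) = ψ (simpleTensor f)) : φ = ψ := by
  ext x
  induction x using UniformSpace.Completion.induction_on with
  | hp => exact isClosed_eq φ.continuous ψ.continuous
  | ih a =>
    obtain ⟨m, c, f, rfl⟩ := exists_eq_sum_algTensor a
    have e : ((∑ i, c i • algTensor (f i) : AlgPower H d) : HilbertPower H d) =
        ∑ i, c i • simpleTensor (f i) := by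
      have h1 := map_sum (UniformSpace.Completion.toComplₗᵢ (𝕜 := ℝ) (E := AlgPower H d))
        (fun i => c i • algTensor (f i)) Finset.univ
      simp only [map_smul] at h1
      exact h1
    rw [e, map_sum, map_sum]
    simp only [map_smul, h]

theorem norm_simpleTensor {d : ℕ} (f : Fin d → H) : ‖simpleTensor f‖ = ∏ k, ‖f k‖ := by
  have h : ‖simpleTensor f‖ ^ 2 = (∏ k, ‖f k‖) ^ 2 := by
    rw [← real_inner_self_eq_norm_sq, inner_simpleTensor, ← Finset.prod_pow]
    simp only [real_inner_self_eq_norm_sq]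
  exact (sq_eq_sq₀ (norm_nonneg _) (Finset.prod_nonneg fun _ _ => norm_nonneg _)).1 h

/-- The tensor product map, as a linear map of one of its arguments. -/
noncomputable def simpleTensorUpdate {d : ℕ} (f : Fin d → H) (k : Fin d) : H →L[ℝ] HilbertPower H d :=
  LinearMap.mkContinuous
    { toFun := fun x => simpleTensor (Function.update f k x)
      map_add' := fun x y => by
        have h := (PiTensorProduct.tprod ℝ (s := fun _ : Fin d => H)).map_update_add f k x y
        have h1 := congrArg (UniformSpace.Completion.toComplₗᵢ (𝕜 := ℝ) (E := AlgPower H d)) h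
        exact h1.trans (map_add (UniformSpace.Completion.toComplₗᵢ (𝕜 := ℝ)
          (E := AlgPower H d)) (algTensor _) (algTensor _))
      map_smul' := fun r x => by
        have h := (PiTensorProduct.tprod ℝ (s := fun _ : Fin d => H)).map_update_smul f k r x
        have h1 := congrArg (UniformSpace.Completion.toComplₗᵢ (𝕜 := ℝ) (E := AlgPower H d)) h
        exact h1.trans (map_smul (UniformSpace.Completion.toComplₗᵢ (𝕜 := ℝ)
          (E := AlgPower H d)) r (algTensor _)) }
    (∏ j ∈ Finset.univ \ {k}, ‖f j‖) fun x => by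
      change ‖simpleTensor (Function.update f k x)‖ ≤ _
      rw [norm_simpleTensor, ← Finset.mul_prod_erase _ _ (Finset.mem_univ k),
        Function.update_self, mul_comm, Finset.sdiff_singleton_eq_erase]
      refine le_of_eq (congrArg (· * ‖x‖) (Finset.prod_congr rfl fun j hj => ?_))
      rw [Function.update_of_ne (Finset.ne_of_mem_erase hj)]

theorem simpleTensorUpdate_apply {d : ℕ} (f : Fin d → H) (k : Fin d) (x : H) :
    simpleTensorUpdate f k x = simpleTensor (Function.update f k x) := rfl

variable {ι : Type*}

/-- Slots are freed one at a time: the tensor is continuous and linear in each slot, so a slot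
filled with a general vector can be expanded in the basis. -/
theorem inner_simpleTensor_eq_zero (b : HilbertBasis ι ℝ H) {d : ℕ} {v : HilbertPower H d}
    (hv : ∀ α : Fin d → ι, inner ℝ (simpleTensor fun k => b (α k)) v = 0) (f : Fin d → H) :
    inner ℝ (simpleTensor f) v = 0 := by
  suffices H : ∀ (t : Finset (Fin d)) (f : Fin d → H), (∀ k ∉ t, f k ∈ Set.range b) →
      inner ℝ (simpleTensor f) v = 0 from H Finset.univ f (by simp)
  intro t
  induction t using Finset.induction_on with
  | empty =>
    intro f hf
    choose α hα using fun k => hf k (Finset.notMem_empty k)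
    rw [← hv α]
    simp only [hα]
  | insert a t ha ih =>
    intro f hf
    have h1 := (b.hasSum_repr (f a)).mapL ((innerSL ℝ v).comp (simpleTensorUpdate f a))
    have h2 : ∀ i, (innerSL ℝ v).comp (simpleTensorUpdate f a) (b.repr (f a) i • b i) = 0 := by
      intro i
      rw [map_smul, smul_eq_zero]
      right
      rw [ContinuousLinearMap.comp_apply, innerSL_apply_apply, simpleTensorUpdate_apply,
        real_inner_comm]
      refine ih _ fun k hk => ?_
      rcases eq_or_ne k a with rfl | hka
      · simp
      · rw [Function.update_of_ne hka]
        exact hf k (by simp [hk, hka])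
    simp only [h2] at h1
    have h3 := h1.unique hasSum_zero
    rw [ContinuousLinearMap.comp_apply, innerSL_apply_apply, simpleTensorUpdate_apply,
      real_inner_comm, Function.update_eq_self] at h3
    exact h3

theorem orthonormal_simpleTensor (b : HilbertBasis ι ℝ H) (d : ℕ) :
    Orthonormal ℝ fun α : Fin d → ι => simpleTensor fun k => b (α k) := by
  classical
  rw [orthonormal_iff_ite]
  intro α β
  rw [inner_simpleTensor]
  simp only [orthonormal_iff_ite.1 b.orthonormal]
  rw [Finset.prod_ite_zero]
  simp [funext_iff]

theorem orthogonal_span_simpleTensor (b : HilbertBasis ι ℝ H) (d : ℕ) :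
    (Submodule.span ℝ (Set.range fun α : Fin d → ι => simpleTensor fun k => b (α k)))ᗮ = ⊥ := by
  rw [eq_bot_iff]
  intro v hv
  rw [Submodule.mem_orthogonal] at hv
  have h1 := inner_simpleTensor_eq_zero b (v := v)
    fun α => hv _ (Submodule.subset_span ⟨α, rfl⟩)
  have h2 : innerSL ℝ v = 0 := hilbertPower_functional_ext fun f => by
    rw [innerSL_apply_apply, real_inner_comm, h1]
    rfl
  have h3 := congrArg (fun φ : HilbertPower H d →L[ℝ] ℝ => φ v) h2
  simpa using h3

/-- The tensor products of the elements of a Hilbert basis form a Hilbert basis. -/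
noncomputable def tensorBasis (b : HilbertBasis ι ℝ H) (d : ℕ) :
    HilbertBasis (Fin d → ι) ℝ (HilbertPower H d) :=
  HilbertBasis.mkOfOrthogonalEqBot (orthonormal_simpleTensor b d) (orthogonal_span_simpleTensor b d)

theorem tensorBasis_apply (b : HilbertBasis ι ℝ H) (d : ℕ) (α : Fin d → ι) :
    tensorBasis b d α = simpleTensor fun k => b (α k) := by
  rw [tensorBasis, HilbertBasis.coe_mkOfOrthogonalEqBot]

variable {S : H →L[ℝ] G} {b : HilbertBasis ι ℝ H} {σ : ι → ℝ}

/-- Both sides are continuous functionals of `x`, and on simple tensors the identity factors over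
the slots. -/
theorem Diagonalizes.tensorOp (h : Diagonalizes b σ S) (d : ℕ) :
    Diagonalizes (tensorBasis b d) (fun α => ∏ k, σ (α k)) (tensorOp S d) := by
  intro α x
  have e : (innerSL ℝ (ScaledTensor.tensorOp S d (tensorBasis b d α))).comp
      (ScaledTensor.tensorOp S d) = (∏ k, σ (α k)) • innerSL ℝ (tensorBasis b d α) := by
    refine hilbertPower_functional_ext fun f => ?_
    rw [ContinuousLinearMap.comp_apply, smul_apply, innerSL_apply_apply,
      innerSL_apply_apply, tensorBasis_apply, tensorOp_simpleTensor, tensorOp_simpleTensor,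
      inner_simpleTensor, inner_simpleTensor, smul_eq_mul, ← Finset.prod_mul_distrib]
    exact Finset.prod_congr rfl fun k _ => h _ _
  exact congrArg (fun φ : HilbertPower H d →L[ℝ] ℝ => φ x) e

/-- Since the other `d - 1` factors are at most `M`, every single factor must be at least `δ * M`.
-/
theorem finite_prod_superlevel {σ : ι → ℝ} (hσ : ∀ i, 0 ≤ σ i) {M : ℝ} (hM : 0 < M)
    (hσM : ∀ i, σ i ≤ M) (hfin : ∀ t, 0 < t → {i | t ≤ σ i}.Finite) {δ : ℝ} (hδ : 0 < δ) (d : ℕ) :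
    {α : Fin d → ι | δ * M ^ d < ∏ k, σ (α k)}.Finite := by
  refine (Set.Finite.pi' fun _ : Fin d => hfin (δ * M) (by positivity)).subset fun α hα k => ?_
  have h1 : ∏ j, σ (α j) ≤ σ (α k) * M ^ (d - 1) := by
    rw [← Finset.mul_prod_erase _ _ (Finset.mem_univ k)]
    refine mul_le_mul_of_nonneg_left ?_ (hσ _)
    refine (Finset.prod_le_prod (fun j _ => hσ (α j)) fun j _ => hσM (α j)).trans_eq ?_
    rw [Finset.prod_const, Finset.card_erase_of_mem (Finset.mem_univ k), Finset.card_univ,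
      Fintype.card_fin]
  have h2 : δ * M ^ d < ∏ k, σ (α k) := hα
  have h3 : M ^ d = M * M ^ (d - 1) := by
    rw [← pow_succ', Nat.sub_add_cancel (by have := k.2; omega)]
  rw [h3, ← mul_assoc] at h2
  exact (lt_of_mul_lt_mul_right (h2.trans_le h1) (by positivity)).le

theorem Diagonalizes.complexity_eq (h : Diagonalizes b σ S) {i₀ : ι} (hmax : ∀ i, σ i ≤ σ i₀)
    (hpos : 0 < σ i₀) (hfin : ∀ t, 0 < t → {i | t ≤ σ i}.Finite) (c : AlgorithmClass)
    (s : ℕ → Set.Ioi (0 : ℝ)) {ε : ℝ} (hε : 0 < ε) (d : ℕ) :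
    complexity c S s ε d = {α : Fin d → ι | ε ^ 2 * σ i₀ ^ d < ∏ k, σ (α k)}.ncard := by
  have hs : (0 : ℝ) < s d := (s d).2
  have hmax' : ∀ α : Fin d → ι, ∏ k, σ (α k) ≤ ∏ k, σ ((fun _ => i₀ : Fin d → ι) k) := fun α =>
    Finset.prod_le_prod (fun k _ => h.nonneg _) fun k _ => hmax _
  have hconst : ∏ k, σ ((fun _ => i₀ : Fin d → ι) k) = σ i₀ ^ d := by simp
  have key := (h.tensorOp d).normComplexity_eq (unscaleL (s d) (HilbertPower H d))
    (fun x => ⟨x, rfl⟩) (Real.sqrt_pos.2 hs) (fun f => norm_unscale (s d) (HilbertPower H d) f) c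
    hmax' hε (by
      rw [hconst]
      exact finite_prod_superlevel h.nonneg hpos hmax hfin (by positivity) d)
  rw [hconst] at key
  exact key

end TensorBasis

/-! ### Spectral data of the problem -/

/-- `σ` is the family of eigenvalues of a compact operator, with largest element `σ i₀ > 0`, and
`lam n` is its `n`-th largest element. -/
structure IsSpectrum {ι : Type*} (σ : ι → ℝ) (i₀ : ι) (lam : ℕ → ℝ) : Prop where
  nonneg : ∀ i, 0 ≤ σ i
  le_max : ∀ i, σ i ≤ σ i₀
  pos : 0 < σ i₀
  finite : ∀ t, 0 < t → {i | t ≤ σ i}.Finite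
  lam_nonneg : ∀ n, 0 ≤ lam n
  le_lam_iff : ∀ {n t}, 1 ≤ n → 0 < t → (t ≤ lam n ↔ n ≤ {i | t ≤ σ i}.ncard)

/-- The set of the `d`-tuples whose product of eigenvalues exceeds `ε²` times the maximum. -/
def largeTuples {ι : Type*} (σ : ι → ℝ) (i₀ : ι) (ε : ℝ) (d : ℕ) : Set (Fin d → ι) :=
  {α | ε ^ 2 * σ i₀ ^ d < ∏ k, σ (α k)}

/-- The spectral data of a compact operator with `λ₂ > 0`, and the formula for the information
complexity in terms of them. -/
theorem exists_isSpectrum {H : Type u} {G : Type*}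
    [NormedAddCommGroup H] [InnerProductSpace ℝ H] [CompleteSpace H]
    [NormedAddCommGroup G] [InnerProductSpace ℝ G] [CompleteSpace G]
    {S : H →L[ℝ] G} (hS : IsCompactOperator S) (h2 : 0 < sqSingularValue S 2) :
    ∃ (ι : Type u) (σ : ι → ℝ) (i₀ : ι), IsSpectrum σ i₀ (sqSingularValue S) ∧
      ∀ (c : AlgorithmClass) (s : ℕ → Set.Ioi (0 : ℝ)) (ε : ℝ) (d : ℕ), 0 < ε →
        complexity c S s ε d = (largeTuples σ i₀ ε d).ncard := by
  obtain ⟨ι, b, σ, h⟩ := exists_diagonalizes hS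
  have hfin : ∀ t, 0 < t → {i | t ≤ σ i}.Finite := fun t ht => h.finite_superlevel hS ht
  have hiff : ∀ n t, 1 ≤ n → 0 < t → (t ≤ sqSingularValue S n ↔ n ≤ {i | t ≤ σ i}.ncard) := by
    intro n t hn ht
    rw [h.sqSingularValue_eq hfin]
    exact le_sSup_superlevel_iff hfin hn ht
  have h3 := (hiff 2 _ (by norm_num) h2).1 le_rfl
  have hne : {i | sqSingularValue S 2 ≤ σ i}.Nonempty :=
    Set.nonempty_of_ncard_ne_zero (by omega)
  obtain ⟨i₀, hi₀, hmax⟩ := (hfin _ h2).exists_maximalFor σ _ hne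
  have hmax' : ∀ i, σ i ≤ σ i₀ := fun i => by
    rcases le_total (σ i) (σ i₀) with h4 | h4
    · exact h4
    · exact hmax (le_trans hi₀ h4) h4
  have hpos : 0 < σ i₀ := h2.trans_le hi₀
  exact ⟨ι, σ, i₀, ⟨h.nonneg, hmax', hpos, hfin,
    fun n => Real.sSup_nonneg fun t ht => ht.1.le, fun hn ht => hiff _ _ hn ht⟩,
    fun c s ε d hε => h.complexity_eq hmax' hpos hfin c s hε d⟩

/-! ### Lower bounds: curse, polynomial and weak tractability -/

section Tractability

variable {ι : Type*} {σ : ι → ℝ} {i₀ : ι} {lam : ℕ → ℝ}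

namespace IsSpectrum

theorem finite_largeTuples (h : IsSpectrum σ i₀ lam) {ε : ℝ} (hε : 0 < ε) (d : ℕ) :
    (largeTuples σ i₀ ε d).Finite :=
  finite_prod_superlevel h.nonneg h.pos h.le_max h.finite (by positivity) d

theorem pos_of_mem_largeTuples (h : IsSpectrum σ i₀ lam) {ε : ℝ} {d : ℕ}
    {α : Fin d → ι} (hα : α ∈ largeTuples σ i₀ ε d) (k : Fin d) : 0 < σ (α k) := by
  refine (h.nonneg _).lt_of_ne fun h0 => ?_
  have h1 : ε ^ 2 * σ i₀ ^ d < ∏ k, σ (α k) := hα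
  rw [Finset.prod_eq_zero (Finset.mem_univ k) h0.symm] at h1
  have := h.pos
  exact absurd h1 (not_lt.2 (by positivity))

theorem lam_one (h : IsSpectrum σ i₀ lam) : lam 1 = σ i₀ := by
  have h1 : σ i₀ ≤ lam 1 := by
    rw [h.le_lam_iff le_rfl h.pos]
    exact (Set.ncard_pos (h.finite _ h.pos)).2 ⟨i₀, le_refl (σ i₀)⟩
  have hpos := h.pos.trans_le h1
  have h2 := (h.le_lam_iff le_rfl hpos).1 le_rfl
  obtain ⟨i, hi⟩ := Set.nonempty_of_ncard_ne_zero (s := {i | lam 1 ≤ σ i}) (by omega)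
  exact le_antisymm (le_trans hi (h.le_max i)) h1

theorem exists_second (h : IsSpectrum σ i₀ lam) (h2 : 0 < lam 2) : ∃ i ≠ i₀, lam 2 ≤ σ i := by
  have h1 := (h.le_lam_iff one_le_two h2).1 le_rfl
  obtain ⟨i, hi, hne⟩ := Set.exists_ne_of_one_lt_ncard (s := {i | lam 2 ≤ σ i}) (by omega) i₀
  exact ⟨i, hne, hi⟩

theorem le_lam_two (h : IsSpectrum σ i₀ lam) {i : ι} (hi : i ≠ i₀) (hpos : 0 < σ i) :
    σ i ≤ lam 2 := by
  rw [h.le_lam_iff one_le_two hpos]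
  exact (Set.one_lt_ncard (h.finite _ hpos)).2 ⟨i, le_refl (σ i), i₀, h.le_max i, hi⟩

/-- A set of coordinates encodes the tuple equal to `i₁` on it and to `i₀` elsewhere. -/
theorem card_le_ncard_largeTuples (h : IsSpectrum σ i₀ lam) {i₁ : ι} (hne : i₁ ≠ i₀) {ε : ℝ}
    (hε : 0 < ε) {d : ℕ} (𝒮 : Finset (Finset (Fin d)))
    (h𝒮 : ∀ s ∈ 𝒮, ε ^ 2 * σ i₀ ^ d < σ i₁ ^ s.card * σ i₀ ^ (d - s.card)) :
    𝒮.card ≤ (largeTuples σ i₀ ε d).ncard := by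
  classical
  rw [← Set.ncard_coe_finset]
  refine Set.ncard_le_ncard_of_injOn (fun s k => if k ∈ s then i₁ else i₀) (fun s hs => ?_)
    (fun s _ t _ hst => ?_) (h.finite_largeTuples hε d)
  · change ε ^ 2 * σ i₀ ^ d < ∏ k, σ (if k ∈ s then i₁ else i₀)
    refine (h𝒮 s hs).trans_eq ?_
    simp only [apply_ite σ]
    rw [Finset.prod_ite, Finset.prod_const, Finset.prod_const, Finset.filter_mem_eq_inter,
      Finset.univ_inter, Finset.filter_notMem_eq_sdiff, Finset.card_sdiff, Finset.inter_univ,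
      Finset.card_univ, Fintype.card_fin]
  · ext k
    have h1 := congrFun hst k
    by_cases hks : k ∈ s <;> by_cases hkt : k ∈ t <;> simp_all

theorem curseOfDimensionality (h : IsSpectrum σ i₀ lam) (h2 : 0 < lam 2) (h12 : lam 1 = lam 2)
    {n : ℝ → ℕ → ℕ} (hn : ∀ ε d, 0 < ε → n ε d = (largeTuples σ i₀ ε d).ncard) :
    CurseOfDimensionality n := by
  obtain ⟨i₁, hne, hi₁⟩ := h.exists_second h2
  have he : σ i₁ = σ i₀ := le_antisymm (h.le_max _) (by rwa [← h.lam_one, h12])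
  refine ⟨1 / 2, by norm_num, 1, one_pos, 1, one_pos, Frequently.of_forall fun d => ?_⟩
  have hpos := h.pos
  have h3 := h.card_le_ncard_largeTuples hne (ε := 1 / 2) (by norm_num) (d := d) Finset.univ
    fun s _ => by
      rw [he, ← pow_add, Nat.add_sub_cancel' (by simpa using s.card_le_univ)]
      have : 0 < σ i₀ ^ d := by positivity
      linarith
  rw [hn _ _ (by norm_num)]
  rw [Finset.card_univ, Fintype.card_finset, Fintype.card_fin] at h3
  norm_num
  exact_mod_cast h3

theorem not_polynomiallyTractable (h : IsSpectrum σ i₀ lam) (h2 : 0 < lam 2)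
    {n : ℝ → ℕ → ℕ} (hn : ∀ ε d, 0 < ε → n ε d = (largeTuples σ i₀ ε d).ncard) :
    ¬ PolynomiallyTractable n := by
  rintro ⟨C, hC, p, hp, q, hq, hb⟩
  obtain ⟨i₁, hne, hi₁⟩ := h.exists_second h2
  have hpos := h.pos
  have hpos1 : 0 < σ i₁ := h2.trans_le hi₁
  obtain ⟨k, hk⟩ := exists_nat_gt q
  set ρ := σ i₁ / σ i₀ with hρ
  have hρ0 : 0 < ρ := by positivity
  have hρ1 : ρ ≤ 1 := (div_le_one hpos).2 (h.le_max _)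
  have hρk0 : 0 < ρ ^ k := by positivity
  have hρk1 : ρ ^ k ≤ 1 := pow_le_one₀ hρ0.le hρ1
  -- As `ρ ^ k ≤ 1`, this gives `ε ^ 2 < ρ ^ k`, so for every `d ≥ k` all tuples with exactly `k`
  -- entries `i₁` are large.
  set ε := ρ ^ k / 2 with hε
  have hε0 : 0 < ε := by positivity
  have hεk : ε ^ 2 < ρ ^ k := by
    rw [hε]
    nlinarith
  have hchoose : ∀ d : ℕ, k ≤ d → ((d.choose k : ℕ) : ℝ) ≤ C * ε ^ (-p) * (d : ℝ) ^ q ∨ d = 0 := by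
    intro d hkd
    rcases Nat.eq_zero_or_pos d with hd | hd
    · exact Or.inr hd
    left
    refine le_trans ?_ (hb d hd ε ⟨hε0, by rw [hε]; linarith⟩)
    rw [hn _ _ hε0]
    have h3 := h.card_le_ncard_largeTuples hne hε0 (d := d) (Finset.powersetCard k Finset.univ)
      fun s hs => by
        rw [(Finset.mem_powersetCard.1 hs).2]
        have e : σ i₁ ^ k * σ i₀ ^ (d - k) = ρ ^ k * σ i₀ ^ d := by
          rw [hρ, div_pow, ← Nat.sub_add_cancel hkd, pow_add, Nat.add_sub_cancel]
          field_simp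
        rw [e]
        gcongr
    rw [Finset.card_powersetCard, Finset.card_univ, Fintype.card_fin] at h3
    exact_mod_cast h3
  -- The last factor comes from `d.choose k ≥ (d / 2) ^ k / k!` for large `d`.
  set B := C * ε ^ (-p) * (k.factorial * 2 ^ k) with hB
  have hlim : Tendsto (fun d : ℕ => (d : ℝ) ^ ((k : ℝ) - q)) atTop atTop :=
    (tendsto_rpow_atTop (sub_pos.2 hk)).comp tendsto_natCast_atTop_atTop
  obtain ⟨d, hd, hd2⟩ := ((hlim.eventually_gt_atTop B).and
    (eventually_ge_atTop (2 * k + 1))).exists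
  have hd0 : (0 : ℝ) < d := by exact_mod_cast (by omega : 0 < d)
  have h4 := (hchoose d (by omega)).resolve_right (by omega)
  have h5 : ((d + 1 - k : ℕ) : ℝ) ^ k ≤ k.factorial * (d.choose k : ℕ) := by
    have := Nat.pow_sub_le_descFactorial d k
    rw [Nat.descFactorial_eq_factorial_mul_choose] at this
    exact_mod_cast this
  have h6 : (d : ℝ) / 2 ≤ ((d + 1 - k : ℕ) : ℝ) := by
    rw [div_le_iff₀ two_pos]
    exact_mod_cast (by omega : d ≤ (d + 1 - k) * 2)
  have h7 : ((d : ℝ) / 2) ^ k ≤ k.factorial * (C * ε ^ (-p) * (d : ℝ) ^ q) :=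
    (pow_le_pow_left₀ (by positivity) h6 k).trans
      (h5.trans (mul_le_mul_of_nonneg_left h4 (by positivity)))
  rw [Real.rpow_sub hd0, Real.rpow_natCast, lt_div_iff₀ (by positivity)] at hd
  rw [div_pow, div_le_iff₀ (by positivity)] at h7
  rw [hB] at hd
  linarith

theorem tendsto_lam (h : IsSpectrum σ i₀ lam) : Tendsto lam atTop (𝓝 0) := by
  rw [Metric.tendsto_atTop]
  intro t ht
  refine ⟨{i | t ≤ σ i}.ncard + 1, fun n hn => ?_⟩
  rw [Real.dist_eq, sub_zero, abs_of_nonneg (h.lam_nonneg n)]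
  by_contra! hle
  have := (h.le_lam_iff (by omega) ht).1 hle
  omega

theorem le_ncard_largeTuples_one (h : IsSpectrum σ i₀ lam) {ε : ℝ} (hε : 0 < ε) {m : ℕ}
    (hm : 1 ≤ m) (hlam : ε ^ 2 * σ i₀ < lam m) : m ≤ (largeTuples σ i₀ ε 1).ncard := by
  have hpos := h.pos
  have h0 : 0 < lam m := lt_of_le_of_lt (by positivity) hlam
  refine ((h.le_lam_iff hm h0).1 le_rfl).trans ?_
  refine Set.ncard_le_ncard_of_injOn (fun i _ => i) (fun i hi => ?_)
    (fun i _ j _ hij => congrFun hij 0) (h.finite_largeTuples hε 1)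
  have hi' : lam m ≤ σ i := hi
  simpa [largeTuples] using hlam.trans_le hi'

end IsSpectrum

theorem weaklyTractable_iff {n : ℝ → ℕ → ℕ} :
    WeaklyTractable n ↔ ∀ δ > 0, ∃ R : ℝ, ∀ (ε : ℝ) (d : ℕ), 0 < ε → ε < 1 → 1 ≤ d → R ≤ ε⁻¹ + (d : ℝ) →
      Real.log (n ε d) < δ * (ε⁻¹ + d) := by
  rw [WeaklyTractable, Metric.tendsto_nhds]
  refine forall₂_congr fun δ hδ => ?_
  rw [eventually_inf_principal, eventually_comap, eventually_atTop]
  refine exists_congr fun R => ⟨fun h ε d h0 h1 hd hR => ?_, fun h r hr x hx hx' => ?_⟩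
  · have h2 := h _ hR (ε, d) rfl ⟨h0, h1, hd⟩
    have h3 : 0 < ε⁻¹ + (d : ℝ) := by positivity
    rw [Real.dist_eq, sub_zero] at h2
    exact (div_lt_iff₀ h3).1 ((le_abs_self _).trans_lt h2)
  · obtain ⟨h0, h1, hd⟩ := hx'
    have h3 : 0 < x.1⁻¹ + (x.2 : ℝ) := by positivity
    rw [Real.dist_eq, sub_zero, abs_of_nonneg (div_nonneg (Real.log_natCast_nonneg _) h3.le),
      div_lt_iff₀ h3]
    exact h x.1 x.2 h0 h1 hd (by rw [hx]; exact hr)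

/-- Only `d = 1` is needed: `ε⁻¹ = x = √(2 λ₁ / λ_m)` puts the threshold at `λ_m / 2`, so `n(ε, 1) ≥
m` and `ln m` is small compared with `x`. -/
theorem IsSpectrum.isLittleO_of_weaklyTractable (h : IsSpectrum σ i₀ lam) {n : ℝ → ℕ → ℕ}
    (hn : ∀ ε d, 0 < ε → n ε d = (largeTuples σ i₀ ε d).ncard) (hw : WeaklyTractable n) :
    lam =o[atTop] fun n : ℕ => (Real.log n ^ 2)⁻¹ := by
  have hpos := h.pos
  rw [isLittleO_iff]
  intro c hc
  -- Chosen so that `lam m * (2 * δ * x) ^ 2 = c`.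
  set δ := √(c / (8 * σ i₀)) with hδ
  have hδ0 : 0 < δ := Real.sqrt_pos.2 (by positivity)
  have hδ2 : δ ^ 2 = c / (8 * σ i₀) := Real.sq_sqrt (by positivity)
  obtain ⟨R, hR⟩ := weaklyTractable_iff.1 hw δ hδ0
  -- The `1` ensures `x > 1`, hence `ε < 1` and `δ * (x + 1) ≤ 2 * δ * x`.
  set R' := max R 1 with hR'
  have hR'1 : 1 ≤ R' := le_max_right _ _
  have hsmall : ∀ᶠ m in atTop, lam m < 2 * σ i₀ / R' ^ 2 :=
    h.tendsto_lam.eventually_lt_const (by positivity)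
  filter_upwards [hsmall, eventually_ge_atTop 2] with m hm hm2
  rw [Real.norm_of_nonneg (h.lam_nonneg m), Real.norm_of_nonneg (by positivity)]
  rcases (h.lam_nonneg m).eq_or_lt with h0 | h0
  · rw [← h0]
    positivity
  set x := √(2 * σ i₀ / lam m) with hx
  have hx2 : x ^ 2 = 2 * σ i₀ / lam m := Real.sq_sqrt (by positivity)
  have hRx : R' < x := by
    refine Real.lt_sqrt_of_sq_lt ?_
    rw [lt_div_iff₀ (by positivity)] at hm ⊢
    linarith
  have hx1 : 1 < x := hR'1.trans_lt hRx
  have hx0 : 0 < x := by linarith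
  have h1 : m ≤ (largeTuples σ i₀ x⁻¹ 1).ncard := by
    refine h.le_ncard_largeTuples_one (by positivity) (by omega) ?_
    rw [inv_pow, hx2, inv_div]
    field_simp
    linarith
  have h2 := hR x⁻¹ 1 (by positivity) (inv_lt_one_of_one_lt₀ hx1) le_rfl
    (by rw [inv_inv]; push_cast; linarith [le_max_left R 1])
  rw [hn _ _ (by positivity), inv_inv] at h2
  have hlogm : 0 < Real.log m := Real.log_pos (by exact_mod_cast hm2)
  have h3 : Real.log m ≤ 2 * δ * x := by
    have h4 : Real.log m ≤ Real.log ((largeTuples σ i₀ x⁻¹ 1).ncard : ℝ) :=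
      Real.log_le_log (by exact_mod_cast (by omega : 0 < m)) (by exact_mod_cast h1)
    push_cast at h2
    nlinarith
  have h4 : Real.log m ^ 2 ≤ (2 * δ * x) ^ 2 := by gcongr
  rw [← div_eq_mul_inv, le_div_iff₀ (by positivity)]
  calc lam m * Real.log m ^ 2 ≤ lam m * (2 * δ * x) ^ 2 := by gcongr
    _ = c := by
      rw [mul_pow, mul_pow, hδ2, hx2]
      field_simp
      norm_num

end Tractability

/-! ### Sufficiency of the decay condition -/

section WeakTractability

/-- The constant `b / (b - 1)` is the one for which `y ≤ b / (b - 1) * (y - 1)` whenever `y ≥ b`;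
multiplying the right side by the remaining product `P ≥ 1` gives the induction step. -/
theorem sum_le_mul_prod {κ : Type*} {b : ℝ} (hb : 1 < b) (A : Finset κ) {x : κ → ℝ}
    (hx : ∀ k ∈ A, b ≤ x k) : 1 ≤ ∏ k ∈ A, x k ∧ ∑ k ∈ A, x k ≤ b / (b - 1) * ∏ k ∈ A, x k := by
  classical
  have hb1 : 0 < b - 1 := by linarith
  induction A using Finset.induction_on with
  | empty =>
    simp only [Finset.prod_empty, Finset.sum_empty, le_refl, mul_one, true_and]
    positivity
  | insert a A ha ih =>
    obtain ⟨h1, h2⟩ := ih fun k hk => hx k (Finset.mem_insert_of_mem hk)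
    have h3 := hx a (Finset.mem_insert_self a A)
    rw [Finset.prod_insert ha, Finset.sum_insert ha]
    refine ⟨one_le_mul_of_one_le_of_one_le (by linarith) h1, ?_⟩
    set P := ∏ k ∈ A, x k
    have h4 : x a ≤ b / (b - 1) * (x a - 1) := by
      rw [div_mul_eq_mul_div, le_div_iff₀ hb1]
      linarith
    have h5 : b / (b - 1) * (x a - 1) ≤ b / (b - 1) * (x a - 1) * P :=
      le_mul_of_one_le_right (mul_nonneg (by positivity) (by linarith)) h1
    linarith

theorem card_mul_log_le {κ : Type*} {b : ℝ} (hb : 1 < b) (A : Finset κ) {x : κ → ℝ}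
    (hx : ∀ k ∈ A, b ≤ x k) : A.card * Real.log b ≤ Real.log (∏ k ∈ A, x k) := by
  have h1 : b ^ A.card ≤ ∏ k ∈ A, x k := by
    rw [← Finset.prod_const]
    exact Finset.prod_le_prod (fun _ _ => by linarith) hx
  rw [← Real.log_pow]
  exact Real.log_le_log (by positivity) h1

variable {ι : Type*} {σ : ι → ℝ} {i₀ : ι} {lam : ℕ → ℝ}

namespace IsSpectrum

/-- The smallest of `m` positive eigenvalues is at most `lam m`; remove it and induct. -/
theorem sum_le_sum_lam (h : IsSpectrum σ i₀ lam) {g : ℝ → ℝ}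
    (hg : ∀ t u, 0 < t → t ≤ u → g t ≤ g u) (J : Finset ι) (hJ : ∀ i ∈ J, 0 < σ i) :
    ∑ i ∈ J, g (σ i) ≤ ∑ n ∈ Finset.range J.card, g (lam (n + 1)) := by
  classical
  induction hc : J.card generalizing J with
  | zero =>
    rw [Finset.card_eq_zero] at hc
    simp [hc]
  | succ m ih =>
    obtain ⟨i, hi, hmin⟩ := J.exists_min_image σ (Finset.card_pos.1 (by omega))
    have h1 := ih (J.erase i) (fun j hj => hJ j (Finset.mem_of_mem_erase hj))
      (by rw [Finset.card_erase_of_mem hi, hc, Nat.add_sub_cancel])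
    have h2 : σ i ≤ lam (m + 1) := by
      rw [h.le_lam_iff (by omega) (hJ i hi), ← hc, ← Set.ncard_coe_finset]
      exact Set.ncard_le_ncard (fun j hj => hmin j hj) (h.finite _ (hJ i hi))
    rw [Finset.sum_range_succ, ← Finset.sum_erase_add _ _ hi]
    exact add_le_add h1 (hg _ _ (hJ i hi) h2)

/-- If `λ_n = o(ln⁻² n)`, then `∑ exp (-a √(λ₁ / λ_n))` over the positive `λ_n` converges. -/
theorem exists_sum_exp_le (h : IsSpectrum σ i₀ lam)
    (ho : lam =o[atTop] fun n : ℕ => (Real.log n ^ 2)⁻¹) {a : ℝ} (ha : 0 < a) :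
    ∃ K : ℝ, 0 ≤ K ∧ ∀ J : Finset ι, (∀ i ∈ J, 0 < σ i) →
      ∑ i ∈ J, Real.exp (-(a * √(σ i₀ / σ i))) ≤ K := by
  have hpos := h.pos
  -- Without the case split, division by zero would turn vanishing `lam n` into terms equal to `1`.
  let g : ℝ → ℝ := fun t => if 0 < t then Real.exp (-(a * √(σ i₀ / t))) else 0
  have hg0 : ∀ t, 0 ≤ g t := fun t => by
    simp only [g]
    split_ifs <;> positivity
  have hg : ∀ t u, 0 < t → t ≤ u → g t ≤ g u := fun t u ht htu => by
    simp only [g, if_pos ht, if_pos (ht.trans_le htu)]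
    gcongr
  have hsum : Summable fun n => g (lam n) := by
    have hs : Summable fun n : ℕ => ((n : ℝ) ^ 2)⁻¹ := Real.summable_nat_pow_inv.2 one_lt_two
    refine hs.of_norm_bounded_eventually_nat ?_
    -- With this constant `a * √(σ i₀ / lam n) ≥ 2 ln n`, so the terms are at most `n⁻²`.
    have hc : 0 < σ i₀ * a ^ 2 / 4 := by positivity
    filter_upwards [(isLittleO_iff.1 ho) hc, eventually_ge_atTop 2] with n hn hn2
    rw [Real.norm_of_nonneg (hg0 _)]
    simp only [g]
    split_ifs with h0
    swap
    · positivity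
    have hn0 : (0 : ℝ) < n := by exact_mod_cast (by omega : 0 < n)
    have hlog : 0 < Real.log n := Real.log_pos (by exact_mod_cast hn2)
    rw [Real.norm_of_nonneg h0.le, Real.norm_of_nonneg (by positivity)] at hn
    have h1 : 2 * Real.log n / a ≤ √(σ i₀ / lam n) := by
      refine Real.le_sqrt_of_sq_le ?_
      rw [← div_eq_mul_inv, le_div_iff₀ (by positivity)] at hn
      rw [le_div_iff₀ h0, div_pow, div_mul_eq_mul_div, div_le_iff₀ (by positivity)]
      linarith
    rw [div_le_iff₀' ha] at h1
    rw [← Real.exp_log (x := ((n : ℝ) ^ 2)⁻¹) (by positivity), Real.log_inv, Real.log_pow]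
    refine Real.exp_le_exp.2 (neg_le_neg ?_)
    push_cast
    exact h1
  have hsum' := (summable_nat_add_iff (f := fun n => g (lam n)) 1).2 hsum
  refine ⟨∑' n, g (lam (n + 1)), tsum_nonneg fun _ => hg0 _, fun J hJ => ?_⟩
  calc ∑ i ∈ J, Real.exp (-(a * √(σ i₀ / σ i))) = ∑ i ∈ J, g (σ i) :=
        Finset.sum_congr rfl fun i hi => by simp only [g, if_pos (hJ i hi)]
    _ ≤ ∑ n ∈ Finset.range J.card, g (lam (n + 1)) := h.sum_le_sum_lam hg J hJ
    _ ≤ _ := hsum'.sum_le_tsum _ fun _ _ => hg0 _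

/-- The square roots have product at most `ε⁻¹` and are each at least `√(lam 1 / lam 2)` on `A`:
`sum_le_mul_prod` controls their sum, `card_mul_log_le` their number. -/
theorem log_weight_le (h : IsSpectrum σ i₀ lam) (h2 : 0 < lam 2) (h12 : lam 2 < lam 1)
    {a z : ℝ} (ha : 0 ≤ a) (hz : 0 ≤ z) {ε : ℝ} (hε : 0 < ε) {d : ℕ} {α : Fin d → ι}
    (hα : α ∈ largeTuples σ i₀ ε d) (A : Finset (Fin d)) (hA : ∀ k, k ∈ A ↔ α k ≠ i₀) :
    ∑ k ∈ A, (a * √(σ i₀ / σ (α k)) + z) ≤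
      a * (√(lam 1 / lam 2) / (√(lam 1 / lam 2) - 1) * ε⁻¹) +
        z * (Real.log ε⁻¹ / Real.log √(lam 1 / lam 2)) := by
  have hpos := h.pos
  have hσ := fun k => h.pos_of_mem_largeTuples hα k
  set b := √(lam 1 / lam 2) with hb
  have hb1 : 1 < b := Real.lt_sqrt_of_sq_lt (by rw [one_pow, lt_div_iff₀ h2]; linarith)
  have hbx : ∀ k ∈ A, b ≤ √(σ i₀ / σ (α k)) := fun k hk => by
    rw [hb, h.lam_one]
    have := hσ k
    have := h.le_lam_two ((hA k).1 hk) (hσ k)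
    gcongr
  have hprod : ∏ k ∈ A, √(σ i₀ / σ (α k)) ≤ ε⁻¹ := by
    have h1 : ∏ k ∈ A, √(σ i₀ / σ (α k)) = ∏ k, √(σ i₀ / σ (α k)) := by
      refine Finset.prod_subset (Finset.subset_univ A) fun k _ hk => ?_
      rw [not_not.1 (fun hne => hk ((hA k).2 hne)), div_self hpos.ne', Real.sqrt_one]
    rw [h1, ← Real.sqrt_prod _ (fun k _ => (div_pos hpos (hσ k)).le)]
    refine Real.sqrt_le_iff.2 ⟨by positivity, ?_⟩
    rw [Finset.prod_div_distrib, Finset.prod_const, Finset.card_univ, Fintype.card_fin,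
      div_le_iff₀ (Finset.prod_pos fun k _ => hσ k), inv_pow, ← div_eq_inv_mul,
      le_div_iff₀ (by positivity), mul_comm]
    exact le_of_lt hα
  obtain ⟨h3, h4⟩ := sum_le_mul_prod hb1 A hbx
  have h5 := card_mul_log_le hb1 A hbx
  have hlogb : 0 < Real.log b := Real.log_pos hb1
  have hb2 : 0 < b - 1 := by linarith
  rw [Finset.sum_add_distrib, ← Finset.mul_sum, Finset.sum_const, nsmul_eq_mul, mul_comm (A.card : ℝ)]
  refine add_le_add (mul_le_mul_of_nonneg_left (h4.trans ?_) ha)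
    (mul_le_mul_of_nonneg_left ?_ hz)
  · gcongr
  · rw [le_div_iff₀ hlogb]
    exact h5.trans (Real.log_le_log (by linarith) hprod)

/-- Counting the large tuples with a product weight. -/
theorem log_ncard_largeTuples_le (h : IsSpectrum σ i₀ lam) (h2 : 0 < lam 2) (h12 : lam 2 < lam 1)
    {a z K : ℝ} (ha : 0 ≤ a) (hz : 0 ≤ z)
    (hK : ∀ J : Finset ι, (∀ i ∈ J, 0 < σ i) →
      ∑ i ∈ J, Real.exp (-(a * √(σ i₀ / σ i))) ≤ K) {ε : ℝ} (hε : 0 < ε) (hε1 : ε < 1) (d : ℕ) :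
    Real.log ((largeTuples σ i₀ ε d).ncard : ℝ) ≤
      a * (√(lam 1 / lam 2) / (√(lam 1 / lam 2) - 1) * ε⁻¹) +
        z * (Real.log ε⁻¹ / Real.log √(lam 1 / lam 2)) + d * (K * Real.exp (-z)) := by
  classical
  have hfin := h.finite_largeTuples hε d
  set T := hfin.toFinset with hT
  have hTmem : ∀ α, α ∈ T ↔ α ∈ largeTuples σ i₀ ε d := fun α => hfin.mem_toFinset
  set M := a * (√(lam 1 / lam 2) / (√(lam 1 / lam 2) - 1) * ε⁻¹) +
        z * (Real.log ε⁻¹ / Real.log √(lam 1 / lam 2)) with hM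
  let J : Finset ι := T.biUnion fun α => Finset.univ.image α
  have hJ : ∀ i ∈ J, 0 < σ i := by
    intro i hi
    obtain ⟨α, hα, hi⟩ := Finset.mem_biUnion.1 hi
    obtain ⟨k, -, rfl⟩ := Finset.mem_image.1 hi
    exact h.pos_of_mem_largeTuples ((hTmem α).1 hα) k
  -- Every large tuple has product weight at least `exp (-M)`, while the total weight of `J ^ d`
  -- factors as the `d`-th power of `∑ w ≤ 1 + K exp (-z)`.
  let w : ι → ℝ := fun i => if i = i₀ then 1 else Real.exp (-(a * √(σ i₀ / σ i) + z))
  have hw0 : ∀ i, 0 ≤ w i := fun i => by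
    simp only [w]
    split_ifs <;> positivity
  have hw : ∀ α ∈ T, Real.exp (-M) ≤ ∏ k, w (α k) := by
    intro α hα
    have h3 := h.log_weight_le h2 h12 ha hz hε ((hTmem α).1 hα)
      (Finset.univ.filter fun k => α k ≠ i₀) (by simp)
    have h4 : ∏ k, w (α k) = Real.exp (-∑ k ∈ Finset.univ.filter (fun k => α k ≠ i₀),
        (a * √(σ i₀ / σ (α k)) + z)) := by
      rw [← Finset.sum_neg_distrib, Real.exp_sum, Finset.prod_filter]
      refine Finset.prod_congr rfl fun k _ => ?_
      by_cases hk : α k = i₀ <;> simp [w, hk]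
    rw [h4]
    exact Real.exp_le_exp.2 (neg_le_neg h3)
  have hsumJ : ∑ i ∈ J, w i ≤ Real.exp (K * Real.exp (-z)) := by
    have h3 : ∑ i ∈ J, w i ≤ 1 + ∑ i ∈ J, Real.exp (-(a * √(σ i₀ / σ i))) * Real.exp (-z) := by
      have h4 : ∀ i ∈ J, w i ≤ (if i = i₀ then 1 else 0) +
          Real.exp (-(a * √(σ i₀ / σ i))) * Real.exp (-z) := by
        intro i _
        simp only [w]
        split_ifs
        · exact le_add_of_nonneg_right (by positivity)
        · rw [zero_add, ← Real.exp_add, neg_add]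
      refine (Finset.sum_le_sum h4).trans ?_
      rw [Finset.sum_add_distrib]
      gcongr
      rw [Finset.sum_ite_eq']
      split_ifs <;> norm_num
    rw [← Finset.sum_mul] at h3
    have h5 := mul_le_mul_of_nonneg_right (hK J hJ) (Real.exp_pos (-z)).le
    have h6 := Real.add_one_le_exp (K * Real.exp (-z))
    linarith
  have hcount : (T.card : ℝ) * Real.exp (-M) ≤ Real.exp (d * (K * Real.exp (-z))) := by
    calc (T.card : ℝ) * Real.exp (-M) = ∑ _α ∈ T, Real.exp (-M) := by
          rw [Finset.sum_const, nsmul_eq_mul]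
      _ ≤ ∑ α ∈ T, ∏ k, w (α k) := Finset.sum_le_sum hw
      _ ≤ ∑ α ∈ Fintype.piFinset fun _ : Fin d => J, ∏ k, w (α k) := by
          refine Finset.sum_le_sum_of_subset_of_nonneg (fun α hα => ?_)
            fun α _ _ => Finset.prod_nonneg fun k _ => hw0 _
          exact Fintype.mem_piFinset.2 fun k => Finset.mem_biUnion.2
            ⟨α, hα, Finset.mem_image_of_mem α (Finset.mem_univ k)⟩
      _ = (∑ i ∈ J, w i) ^ d := by
          rw [← Finset.prod_univ_sum, Finset.prod_const, Finset.card_univ, Fintype.card_fin]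
      _ ≤ Real.exp (K * Real.exp (-z)) ^ d :=
          pow_le_pow_left₀ (Finset.sum_nonneg fun i _ => hw0 i) hsumJ d
      _ = Real.exp (d * (K * Real.exp (-z))) := (Real.exp_nat_mul _ d).symm
  rw [Set.ncard_eq_toFinset_card _ hfin]
  have hTpos : 0 < T.card := by
    refine Finset.card_pos.2 ⟨fun _ => i₀, (hTmem _).2 ?_⟩
    have hpos := h.pos
    have : ε ^ 2 < 1 := pow_lt_one₀ hε.le hε1 two_ne_zero
    simpa [largeTuples] using mul_lt_of_lt_one_left (pow_pos hpos d) this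
  have h7 : (T.card : ℝ) ≤ Real.exp (M + d * (K * Real.exp (-z))) := by
    rw [Real.exp_neg, ← div_eq_mul_inv, div_le_iff₀ (Real.exp_pos M)] at hcount
    rw [Real.exp_add, mul_comm]
    exact hcount
  exact (Real.log_le_iff_le_exp (by exact_mod_cast hTpos)).2 h7

/-- The parameters are chosen in order: `a` makes the first term `η ε⁻¹`; it determines `K`; then
`z` makes the term in `d` at most `η d`. The logarithmic term is absorbed last. -/
theorem weaklyTractable_of_isLittleO (h : IsSpectrum σ i₀ lam) (h2 : 0 < lam 2)
    (h12 : lam 2 < lam 1) {n : ℝ → ℕ → ℕ}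
    (hn : ∀ ε d, 0 < ε → n ε d = (largeTuples σ i₀ ε d).ncard)
    (ho : lam =o[atTop] fun n : ℕ => (Real.log n ^ 2)⁻¹) : WeaklyTractable n := by
  rw [weaklyTractable_iff]
  intro δ hδ
  set b := √(lam 1 / lam 2) with hb
  have hb1 : 1 < b := Real.lt_sqrt_of_sq_lt (by rw [one_pow, lt_div_iff₀ h2]; linarith)
  have hlogb : 0 < Real.log b := Real.log_pos hb1
  have hb2 : 0 < b - 1 := by linarith
  set C := b / (b - 1) with hC
  have hC0 : 0 < C := by positivity
  set η := δ / 4 with hη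
  have hη0 : 0 < η := by positivity
  obtain ⟨K, hK0, hK⟩ := h.exists_sum_exp_le ho (a := η / C) (by positivity)
  set z := Real.log (1 + K / η) with hz
  have hz0 : 0 ≤ z := Real.log_nonneg (by have : 0 ≤ K / η := by positivity
                                          linarith)
  have hKz : K * Real.exp (-z) ≤ η := by
    have h1 : 0 < 1 + K / η := by positivity
    rw [Real.exp_neg, hz, Real.exp_log h1, ← div_eq_mul_inv, div_le_iff₀ h1, mul_add,
      mul_div_cancel₀ _ hη0.ne']
    linarith
  set L := z / Real.log b with hL
  have hL0 : 0 ≤ L := by positivity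
  -- From `ln (θ y) ≤ θ y - 1` one gets `ln ε⁻¹ ≤ θ ε⁻¹ + |ln θ|`; here `L θ ≤ η`, and the constant
  -- `L |ln θ|` is covered by the choice of `R`.
  set θ := η / (L + 1) with hθ
  have hθ0 : 0 < θ := by positivity
  have hLθ : L * θ ≤ η := by
    rw [hθ, mul_div_assoc', div_le_iff₀ (by positivity)]
    nlinarith
  refine ⟨(L * |Real.log θ| + 1) / η, fun ε d hε hε1 hd hR => ?_⟩
  rw [hn ε d hε]
  have h1 := h.log_ncard_largeTuples_le h2 h12 (a := η / C) (by positivity) hz0 hK hε hε1 d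
  rw [← hb, ← hC] at h1
  have hεi : 0 < ε⁻¹ := by positivity
  have h3 : Real.log ε⁻¹ ≤ θ * ε⁻¹ + |Real.log θ| := by
    have h4 := Real.log_le_sub_one_of_pos (mul_pos hθ0 hεi)
    rw [Real.log_mul hθ0.ne' hεi.ne'] at h4
    have h5 := neg_abs_le (Real.log θ)
    linarith
  have h4 : z * (Real.log ε⁻¹ / Real.log b) ≤ η * ε⁻¹ + L * |Real.log θ| := by
    calc z * (Real.log ε⁻¹ / Real.log b) = L * Real.log ε⁻¹ := by rw [hL]; ring
      _ ≤ L * (θ * ε⁻¹ + |Real.log θ|) := mul_le_mul_of_nonneg_left h3 hL0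
      _ = L * θ * ε⁻¹ + L * |Real.log θ| := by ring
      _ ≤ η * ε⁻¹ + L * |Real.log θ| := by gcongr
  have h5 : η / C * (C * ε⁻¹) = η * ε⁻¹ := by field_simp
  have h6 : (d : ℝ) * (K * Real.exp (-z)) ≤ d * η := by gcongr
  rw [div_le_iff₀ hη0] at hR
  have h7 : 0 ≤ (d : ℝ) * η := by positivity
  have h8 : δ = 4 * η := by rw [hη]; ring
  rw [h5] at h1
  rw [h8]
  nlinarith [mul_pos hη0 hεi]

end IsSpectrum

end WeakTractability

end ScaledTensor

theorem theorem3p8 {H G : Type*}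
    [NormedAddCommGroup H] [InnerProductSpace ℝ H] [CompleteSpace H]
    [NormedAddCommGroup G] [InnerProductSpace ℝ G] [CompleteSpace G]
    (S : H →L[ℝ] G) (hS : IsCompactOperator S)
    (h2 : 0 < ScaledTensor.sqSingularValue S 2)
    (s : ℕ → Set.Ioi (0 : ℝ)) (c : ScaledTensor.AlgorithmClass) :
    (∀ d : ℕ, 1 ≤ d → ∀ ε : ℝ, 0 < ε →
      ScaledTensor.complexity c S s ε d =
        ScaledTensor.complexity c S (fun _ => ⟨1, Set.mem_Ioi.2 one_pos⟩) ε d) ∧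
    (ScaledTensor.sqSingularValue S 1 = ScaledTensor.sqSingularValue S 2 →
      ScaledTensor.CurseOfDimensionality (ScaledTensor.complexity c S s)) ∧
    (ScaledTensor.sqSingularValue S 2 < ScaledTensor.sqSingularValue S 1 →
      ¬ ScaledTensor.PolynomiallyTractable (ScaledTensor.complexity c S s) ∧
      (ScaledTensor.WeaklyTractable (ScaledTensor.complexity c S s) ↔
        (fun n : ℕ => ScaledTensor.sqSingularValue S n) =o[atTop]
          fun n : ℕ => (Real.log n ^ 2)⁻¹)) := by
  obtain ⟨ι, σ, i₀, h, hn⟩ := ScaledTensor.exists_isSpectrum hS h2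
  refine ⟨fun d _ ε hε => ?_, fun h12 => h.curseOfDimensionality h2 h12 (hn c s),
    fun h12 => ⟨h.not_polynomiallyTractable h2 (hn c s), h.isLittleO_of_weaklyTractable (hn c s),
      h.weaklyTractable_of_isLittleO h2 h12 (hn c s)⟩⟩
  rw [hn c s ε d hε, hn c _ ε d hε]
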